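/- Let $k\ge 1$ be an integer, $m>0$ real and $0<\varepsilon<1$. Consider the following random experiment. Let $X\in\{0,1\}$ be a uniform bit, and, independently of $X$, let $x_0,\dots,x_{k-1}$ be independent and uniform on $[0,(1-\varepsilon)/k]$. Given $X$ and $x=(x_i)$, define two probability distributions $p,q$ on $[0,1)$ as follows. Divide $[0,1)$ into $k$ consecutive macro-buckets $[i/k,(i+1)/k)$, $0\le i<k$; the mini-bucket of the $i$-th macro-bucket is $[\,i/k+x_i,\ i/k+x_i+\varepsilon/k)$. If $X=1$, then $p=q$ is the uniform distribution. If $X=0$, then $p$ and $q$ both have density $1$ outside the mini-buckets, while in each mini-bucket $p$ has density $2$ on the middle half and $0$ on the first and last quarters, and $q$ has density $0$ on the middle half and $2$ on the first and last quarters. (So each macro-bucket consists of an interval of mass $x_i$ on which $p=q$, a mini-bucket of mass $\varepsilon/k$ under both $p$ and $q$, and an interval of mass $(1-\varepsilon)/k-x_i$ on which $p=q$; for $X=0$ the mini-bucket splits into three consecutive intervals of $q$-mass $\varepsilon/(2k),0,\varepsilon/(2k)$ and $p$-mass $0,\varepsilon/k,0$.) Given $p$ and $q$, draw $\mathrm{Poi}(m)$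 independent samples from $p$ and, independently, $\mathrm{Poi}(m)$ independent samples from $q$, and let $Y$ be the ordering of the draws: the finite word over $\{p,q\}$ obtained by listing all draws in increasing order and recording for each one whether it came from $p$ or from $q$. Let $I(X:Y)$ be the mutual information of $X$ and $Y$. Theorem. There are absolute constants $c,C>0$ such that, for all $k,m,\varepsilon$ as above with $m\varepsilon\le c\,k$, $\log(mk/\varepsilon)\le c\,\varepsilon^{-1}$ and $k\le c\,m$, $$I(X:Y)\ \le\ C\,\frac{m^5\varepsilon^6}{k^4}.$$ -/

import Mathlib

open MeasureTheory ProbabilityTheory Set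
open scoped ENNReal NNReal

noncomputable section

namespace OrderedSampling

/-- Mutual information (in nats) of the two coordinates of a pair with joint law `ρ`:
the Kullback-Leibler divergence of `ρ` from the product of its marginals. -/
def mutualInfo {α β : Type*} [MeasurableSpace α] [MeasurableSpace β] (ρ : Measure (α × β)) :
    ℝ≥0∞ :=
  InformationTheory.klDiv ρ (ρ.fst.prod ρ.snd)

/-! ### The random pair of distributions

The domain is `[0, 1)`, parametrised by mass under `(p + q) / 2`.
The `i`-th macro-bucket is `[i / k, (i + 1) / k)`, and its mini-bucket is
`[i / k + x i, i / k + x i + ε / k)`. -/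

/-- The point `t` lies in one of the mini-buckets. -/
def InMini (k : ℕ) (ε : ℝ) (x : Fin k → ℝ) (t : ℝ) : Prop :=
  ∃ i : Fin k, (i : ℝ) / k + x i ≤ t ∧ t < (i : ℝ) / k + x i + ε / k

/-- The point `t` lies in the middle half of one of the mini-buckets. -/
def InMiddle (k : ℕ) (ε : ℝ) (x : Fin k → ℝ) (t : ℝ) : Prop :=
  ∃ i : Fin k, (i : ℝ) / k + x i + ε / (4 * k) ≤ t ∧ t < (i : ℝ) / k + x i + 3 * ε / (4 * k)

open Classical in
/-- Density of `p` on `[0, 1)`. If `X = 1` it is uniform. If `X = 0`, then `p` is uniform off the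
mini-buckets and has the whole mass `ε / k` of each mini-bucket on its middle half. -/
def pDensity (k : ℕ) (ε : ℝ) (X : Fin 2) (x : Fin k → ℝ) (t : ℝ) : ℝ≥0∞ :=
  if X = 0 ∧ InMini k ε x t then (if InMiddle k ε x t then 2 else 0) else 1

open Classical in
/-- Density of `q` on `[0, 1)`. If `X = 1` it is uniform. If `X = 0`, then `q` is uniform off the
mini-buckets and has mass `ε / (2 * k)` on the first and on the last quarter of each mini-bucket. -/
def qDensity (k : ℕ) (ε : ℝ) (X : Fin 2) (x : Fin k → ℝ) (t : ℝ) : ℝ≥0∞ :=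
  if X = 0 ∧ InMini k ε x t then (if InMiddle k ε x t then 0 else 2) else 1

/-- The distribution `p`, given `X` and the positions `x` of the mini-buckets. -/
def pLaw (k : ℕ) (ε : ℝ) (X : Fin 2) (x : Fin k → ℝ) : Measure ℝ :=
  (volume.restrict (Ico 0 1)).withDensity (pDensity k ε X x)

/-- The distribution `q`, given `X` and the positions `x` of the mini-buckets. -/
def qLaw (k : ℕ) (ε : ℝ) (X : Fin 2) (x : Fin k → ℝ) : Measure ℝ :=
  (volume.restrict (Ico 0 1)).withDensity (qDensity k ε X x)

/-! ### The ordering of a sample -/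

/-- Words over the two-letter alphabet: `false` stands for a draw from `p` and `true` for a draw
from `q`. Every set of words is measurable. -/
instance : MeasurableSpace (List Bool) := ⊤

instance : DiscreteMeasurableSpace (List Bool) := ⟨fun _ => trivial⟩

open Classical in
/-- The word obtained by listing all draws in increasing order with respect to the comparison
relation `r` and recording for each of them whether it was drawn from `p` or from `q`. -/
def wordOf (a b : ℕ) (r : Fin a ⊕ Fin b → Fin a ⊕ Fin b → Prop) : List Bool :=
  (((List.finRange a).map Sum.inl ++ (List.finRange b).map Sum.inr).insertionSort r).map
    Sum.isRight

/-- The ordering of the draws `z.1` from `p` and `z.2` from `q`. -/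
def ordering (a b : ℕ) (z : (Fin a → ℝ) × (Fin b → ℝ)) : List Bool :=
  wordOf a b (fun s t => Sum.elim z.1 z.2 s ≤ Sum.elim z.1 z.2 t)

/-- The law of the ordering of `a` independent draws from `p` and `b` independent draws
from `q`. -/
def orderingLaw (p q : Measure ℝ) (a b : ℕ) : Measure (List Bool) :=
  ((Measure.pi fun _ : Fin a => p).prod (Measure.pi fun _ : Fin b => q)).map (ordering a b)

/-! ### Measurability -/

lemma measurable_ordering (a b : ℕ) : Measurable (ordering a b) := by
  have h : Measurable fun (z : (Fin a → ℝ) × (Fin b → ℝ)) (s t : Fin a ⊕ Fin b) =>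
      Sum.elim z.1 z.2 s ≤ Sum.elim z.1 z.2 t := by
    have hc : ∀ s : Fin a ⊕ Fin b,
        Measurable fun z : (Fin a → ℝ) × (Fin b → ℝ) => Sum.elim z.1 z.2 s := by
      rintro (i | j)
      · exact (measurable_pi_apply i).comp measurable_fst
      · exact (measurable_pi_apply j).comp measurable_snd
    refine measurable_pi_iff.2 fun s => measurable_pi_iff.2 fun t => ?_
    exact measurableSet_setOfPred.1 (measurableSet_le (hc s) (hc t))
  exact (Measurable.of_discrete (f := wordOf a b)).comp h

lemma measurableSet_inMini (k : ℕ) (ε : ℝ) :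
    MeasurableSet {w : (Fin 2 × (Fin k → ℝ)) × ℝ | InMini k ε w.1.2 w.2} := by
  simp only [InMini, Set.ofPred_exists, Set.ofPred_and]
  refine MeasurableSet.iUnion fun i => (measurableSet_le ?_ ?_).inter (measurableSet_lt ?_ ?_) <;>
    fun_prop

lemma measurableSet_inMiddle (k : ℕ) (ε : ℝ) :
    MeasurableSet {w : (Fin 2 × (Fin k → ℝ)) × ℝ | InMiddle k ε w.1.2 w.2} := by
  simp only [InMiddle, Set.ofPred_exists, Set.ofPred_and]
  refine MeasurableSet.iUnion fun i => (measurableSet_le ?_ ?_).inter (measurableSet_lt ?_ ?_) <;>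
    fun_prop

lemma measurableSet_zero_inMini (k : ℕ) (ε : ℝ) :
    MeasurableSet {w : (Fin 2 × (Fin k → ℝ)) × ℝ | w.1.1 = 0 ∧ InMini k ε w.1.2 w.2} :=
  ((measurable_fst.comp measurable_fst) (measurableSet_singleton (0 : Fin 2))).inter
    (measurableSet_inMini k ε)

lemma measurable_pDensity (k : ℕ) (ε : ℝ) :
    Measurable fun w : (Fin 2 × (Fin k → ℝ)) × ℝ => pDensity k ε w.1.1 w.1.2 w.2 :=
  Measurable.ite (measurableSet_zero_inMini k ε)
    (Measurable.ite (measurableSet_inMiddle k ε) measurable_const measurable_const)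
    measurable_const

lemma measurable_qDensity (k : ℕ) (ε : ℝ) :
    Measurable fun w : (Fin 2 × (Fin k → ℝ)) × ℝ => qDensity k ε w.1.1 w.1.2 w.2 :=
  Measurable.ite (measurableSet_zero_inMini k ε)
    (Measurable.ite (measurableSet_inMiddle k ε) measurable_const measurable_const)
    measurable_const

lemma measurable_pLaw (k : ℕ) (ε : ℝ) :
    Measurable fun w : Fin 2 × (Fin k → ℝ) => pLaw k ε w.1 w.2 := by
  refine Measure.measurable_of_measurable_coe _ fun s hs => ?_
  simp only [pLaw, withDensity_apply _ hs]
  exact (measurable_pDensity k ε).lintegral_prod_right'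

lemma measurable_qLaw (k : ℕ) (ε : ℝ) :
    Measurable fun w : Fin 2 × (Fin k → ℝ) => qLaw k ε w.1 w.2 := by
  refine Measure.measurable_of_measurable_coe _ fun s hs => ?_
  simp only [qLaw, withDensity_apply _ hs]
  exact (measurable_qDensity k ε).lintegral_prod_right'

lemma isFiniteMeasure_withDensity_le_two (f : ℝ → ℝ≥0∞) (hf : ∀ t, f t ≤ 2) :
    IsFiniteMeasure ((volume.restrict (Ico (0 : ℝ) 1)).withDensity f) := by
  refine isFiniteMeasure_withDensity (ne_top_of_le_ne_top ?_ (lintegral_mono hf))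
  simp

instance (k : ℕ) (ε : ℝ) (X : Fin 2) (x : Fin k → ℝ) : IsFiniteMeasure (pLaw k ε X x) :=
  isFiniteMeasure_withDensity_le_two _ fun t => by
    unfold pDensity; split_ifs <;> simp

instance (k : ℕ) (ε : ℝ) (X : Fin 2) (x : Fin k → ℝ) : IsFiniteMeasure (qLaw k ε X x) :=
  isFiniteMeasure_withDensity_le_two _ fun t => by
    unfold qDensity; split_ifs <;> simp

lemma measurable_pi_const {S : Type*} [MeasurableSpace S] (μ : S → Measure ℝ)
    [∀ s, IsFiniteMeasure (μ s)] (hμ : Measurable μ) (n : ℕ) :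
    Measurable fun s => Measure.pi fun _ : Fin n => μ s := by
  refine Measurable.measure_of_isPiSystem generateFrom_pi.symm isPiSystem_pi ?_ ?_
  · rintro _ ⟨u, hu, rfl⟩
    simp only [Measure.pi_pi]
    refine Finset.measurable_prod _ fun i _ => (Measure.measurable_coe ?_).comp hμ
    simpa using hu i trivial
  · simp only [Measure.pi_univ]
    exact Finset.measurable_prod _ fun i _ => (Measure.measurable_coe MeasurableSet.univ).comp hμ

lemma measurable_prod_measure {S α β : Type*} [MeasurableSpace S] [MeasurableSpace α]
    [MeasurableSpace β] (μ : S → Measure α) (ν : S → Measure β) [∀ s, IsFiniteMeasure (μ s)]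
    [∀ s, IsFiniteMeasure (ν s)] (hμ : Measurable μ) (hν : Measurable ν) :
    Measurable fun s => (μ s).prod (ν s) := by
  refine Measurable.measure_of_isPiSystem generateFrom_prod.symm isPiSystem_prod ?_ ?_
  · rintro _ ⟨u, hu, v, hv, rfl⟩
    simp only [Measure.prod_prod]
    exact ((Measure.measurable_coe hu).comp hμ).mul ((Measure.measurable_coe hv).comp hν)
  · simp only [← univ_prod_univ, Measure.prod_prod]
    exact ((Measure.measurable_coe MeasurableSet.univ).comp hμ).mul
      ((Measure.measurable_coe MeasurableSet.univ).comp hν)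

lemma measurable_orderingLaw (k : ℕ) (ε : ℝ) (a b : ℕ) :
    Measurable fun w : Fin 2 × (Fin k → ℝ) =>
      orderingLaw (pLaw k ε w.1 w.2) (qLaw k ε w.1 w.2) a b := by
  have hp := measurable_pi_const (fun w : Fin 2 × (Fin k → ℝ) => pLaw k ε w.1 w.2)
    (measurable_pLaw k ε) a
  have hq := measurable_pi_const (fun w : Fin 2 × (Fin k → ℝ) => qLaw k ε w.1 w.2)
    (measurable_qLaw k ε) b
  have hpq := measurable_prod_measure
    (fun w : Fin 2 × (Fin k → ℝ) => Measure.pi fun _ : Fin a => pLaw k ε w.1 w.2)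
    (fun w : Fin 2 × (Fin k → ℝ) => Measure.pi fun _ : Fin b => qLaw k ε w.1 w.2) hp hq
  have h := (Measure.measurable_map _ (measurable_ordering a b)).comp hpq
  simpa only [orderingLaw, Function.comp_def] using h

lemma pLaw_univ_le (k : ℕ) (ε : ℝ) (X : Fin 2) (x : Fin k → ℝ) : pLaw k ε X x univ ≤ 2 := by
  rw [pLaw, withDensity_apply _ MeasurableSet.univ]
  refine (lintegral_mono (g := fun _ => 2) fun t => ?_).trans (by simp)
  unfold pDensity; split_ifs <;> simp

lemma qLaw_univ_le (k : ℕ) (ε : ℝ) (X : Fin 2) (x : Fin k → ℝ) : qLaw k ε X x univ ≤ 2 := by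
  rw [qLaw, withDensity_apply _ MeasurableSet.univ]
  refine (lintegral_mono (g := fun _ => 2) fun t => ?_).trans (by simp)
  unfold qDensity; split_ifs <;> simp

lemma orderingLaw_univ_le (k : ℕ) (ε : ℝ) (X : Fin 2) (x : Fin k → ℝ) (a b : ℕ) :
    orderingLaw (pLaw k ε X x) (qLaw k ε X x) a b univ ≤ 2 ^ a * 2 ^ b := by
  rw [orderingLaw, Measure.map_apply (measurable_ordering a b) MeasurableSet.univ, preimage_univ,
    ← univ_prod_univ, Measure.prod_prod, Measure.pi_univ, Measure.pi_univ]
  simp only [Finset.prod_const, Finset.card_univ, Fintype.card_fin]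
  gcongr
  · exact pLaw_univ_le k ε X x
  · exact qLaw_univ_le k ε X x

/-! ### The joint law of `X` and `Y` -/

/-- The law of the randomness `(X, x, N, N')` behind a sample: a uniform bit `X`, independent
uniform positions `x i` in `[0, (1 - ε) / k]` of the mini-buckets within their macro-buckets, and
independent Poisson numbers, of mean `m`, of draws from `p` and from `q`. -/
def setupLaw (k : ℕ) (ε : ℝ) (m : ℝ≥0) : Measure ((Fin 2 × (Fin k → ℝ)) × (ℕ × ℕ)) :=
  ((uniformOn (univ : Set (Fin 2))).prod
      (Measure.pi fun _ : Fin k => (volume : Measure ℝ)[|Icc 0 ((1 - ε) / k)])).prod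
    ((poissonMeasure m).prod (poissonMeasure m))

/-- The conditional law of the ordering `Y`, given `(X, x, N, N')`. -/
def orderingKernel (k : ℕ) (ε : ℝ) :
    Kernel ((Fin 2 × (Fin k → ℝ)) × (ℕ × ℕ)) (List Bool) where
  toFun w := orderingLaw (pLaw k ε w.1.1 w.1.2) (qLaw k ε w.1.1 w.1.2) w.2.1 w.2.2
  measurable' := measurable_from_prod_countable_left fun n =>
    measurable_orderingLaw k ε n.1 n.2

instance (k : ℕ) (ε : ℝ) : IsSFiniteKernel (orderingKernel k ε) := by
  classical
  have hs : ∀ n : ℕ × ℕ,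
      MeasurableSet (Prod.snd ⁻¹' {n} : Set ((Fin 2 × (Fin k → ℝ)) × (ℕ × ℕ))) :=
    fun n => measurable_snd (measurableSet_singleton n)
  have hfin : ∀ n, IsFiniteKernel (Kernel.piecewise (hs n) (orderingKernel k ε) 0) := fun n => by
    refine ⟨2 ^ n.1 * 2 ^ n.2, ENNReal.mul_lt_top (by simp) (by simp), ?_⟩
    rintro ⟨w, n'⟩
    rw [Kernel.piecewise_apply]
    split_ifs with h
    · obtain rfl : n' = n := h
      exact orderingLaw_univ_le k ε w.1 w.2 n'.1 n'.2
    · simp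
  have hsum : orderingKernel k ε =
      Kernel.sum fun n => Kernel.piecewise (hs n) (orderingKernel k ε) 0 := by
    ext ⟨w, n⟩ s hs'
    rw [Kernel.sum_apply' _ _ hs', tsum_eq_single n]
    · simp [Kernel.piecewise_apply]
    · intro n' hn
      simp [Kernel.piecewise_apply, Ne.symm hn]
  rw [hsum]
  infer_instance

/-- The joint law of the bit `X` and the ordering `Y` of the sample. -/
def jointLaw (k : ℕ) (ε : ℝ) (m : ℝ≥0) : Measure (Fin 2 × List Bool) :=
  (setupLaw k ε m ⊗ₘ orderingKernel k ε).map fun w => (w.1.1.1, w.2)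

end OrderedSampling

end

/-! Conditionally on the bit and the positions, Poisson sampling makes the probability of a word `w`
equal to `exp (-2m)` times an integral over an ordered simplex (`orderingLaw_eq_iterInt`,
`lintegral_poisson_orderingLaw`). Such integrals turn a subdivision of the interval into a
convolution over splittings of the word (`iterInt_split`). Since the positions are independent, the
weight of `w` is the `k`-fold convolution of one averaged macro-bucket weight when `X = 0`, and the
flat weight `m ^ n / n!` (`n` the length of `w`) when `X = 1`.

In one macro-bucket holding `n` letters, the mini-bucket holds a binomial number `j` of them. By the
Beta integral, averaging over its position makes the start of this block of `j` letters uniform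
among the `n - j + 1` possibilities. The likelihood ratio is therefore an average, over random
blocks, of a ratio `H` of the block. Three facts about `H` suffice: it is at most `2 ^ j`, it has
mean `1` under uniform letters, and it is identically `1` on at most two letters (`miniRatio_le`,
`sumLen_miniRatio`, `miniRatio_eq_one`).

The second moment of the ratio involves two independent random blocks. Disjoint blocks see
independent letters and contribute exactly `1`, and so do blocks with at most two letters. An excess
arises only from two overlapping blocks of length at least `3`, which costs about `(n ε) ^ 3 * (n ε)
^ 3 / n = n ^ 5 ε ^ 6` (`sum_overlap_le`, `sumLen_macroRatio_sq_le`). With `t = m / k`, `t ≥ 1` and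
`t ε ≤ 1`, summing over `n` gives the normalised second moment `1 + O (t ^ 5 ε ^ 6)`
(`chi_macroWeight_le`).

Forgetting the cuts between buckets does not increase second moments (`chi_conv_le`), so the whole
word has second moment at most `exp (O (k t ^ 5 ε ^ 6)) = exp (O (m ^ 5 ε ^ 6 / k ^ 4))`. Finally,
mutual information with a bit is bounded by a chi-square divergence (`mutualInfo_le_of_chi_le`). -/

namespace OrderedSampling

/-! ### Convolution of functions on words -/

section Conv

variable {R S : Type*} [CommSemiring R] [CommSemiring S]

/-- The sum of `A u * B v` over all splittings of a word as `u ++ v`. -/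
def conv : (List Bool → R) → (List Bool → R) → List Bool → R
  | A, B, [] => A [] * B []
  | A, B, l :: w => A [] * B (l :: w) + conv (fun u => A (l :: u)) B w

/-- The unit of `conv`. -/
def convOne : List Bool → R
  | [] => 1
  | _ :: _ => 0

lemma conv_eq_sum (A B : List Bool → R) (w : List Bool) :
    conv A B w = ∑ i ∈ Finset.range (w.length + 1), A (w.take i) * B (w.drop i) := by
  induction w generalizing A with
  | nil => simp [conv]
  | cons l w ih =>
    rw [conv, ih, List.length_cons, Finset.sum_range_succ' _ (w.length + 1), add_comm]
    simp

lemma map_conv (f : R →+* S) (A B : List Bool → R) (w : List Bool) :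
    f (conv A B w) = conv (fun u => f (A u)) (fun u => f (B u)) w := by
  simp [conv_eq_sum, map_sum, map_mul]

lemma map_convOne (f : R →+* S) (w : List Bool) : f (convOne w) = convOne w := by
  cases w <;> simp [convOne]

lemma conv_mul_left (c : R) (A B : List Bool → R) (w : List Bool) :
    conv (fun u => c * A u) B w = c * conv A B w := by
  simp [conv_eq_sum, Finset.mul_sum, mul_assoc]

lemma conv_convOne (A : List Bool → R) : conv A convOne = A := by
  funext w
  rw [conv_eq_sum, Finset.sum_range_succ, Finset.sum_eq_zero]
  · simp [convOne]
  · intro i hi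
    have hi' := Finset.mem_range.1 hi
    obtain ⟨l, v, hv⟩ : ∃ l v, w.drop i = l :: v := by
      apply List.exists_cons_of_ne_nil
      simp [hi']
    simp [hv, convOne]

lemma conv_mono {A A' B B' : List Bool → ℝ≥0} (hA : ∀ u, A u ≤ A' u) (hB : ∀ u, B u ≤ B' u)
    (w : List Bool) : conv A B w ≤ conv A' B' w := by
  rw [conv_eq_sum, conv_eq_sum]
  exact Finset.sum_le_sum fun i _ => mul_le_mul' (hA _) (hB _)

/-- The convolution of a list of functions on words. -/
def convFold (L : List (List Bool → R)) : List Bool → R := L.foldr conv convOne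

lemma map_convFold (f : R →+* S) (L : List (List Bool → R)) (w : List Bool) :
    f (convFold L w) = convFold (L.map fun A u => f (A u)) w := by
  induction L generalizing w with
  | nil => simpa [convFold] using map_convOne f w
  | cons A L ih =>
    simp only [convFold, List.foldr_cons, List.map_cons] at ih ⊢
    rw [map_conv]
    congr 1
    funext u
    exact ih u

end Conv

/-! ### Sums over words -/

/-- The sum of `F` over all words of length `n`. -/
def sumLen {R : Type*} [AddCommMonoid R] (n : ℕ) (F : List Bool → R) : R :=
  ∑ f : Fin n → Bool, F (List.ofFn f)

/-- Grading by length is what lets the later estimates be made for a fixed number of draws and then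
summed against Poisson weights. -/
lemma tsum_list_eq (F : List Bool → ℝ≥0∞) : ∑' w, F w = ∑' n, sumLen n F := by
  rw [← (List.equivSigmaTuple (α := Bool)).symm.tsum_eq F, ENNReal.tsum_sigma']
  refine tsum_congr fun n => ?_
  rw [tsum_fintype]
  rfl

section SumLen

variable {R : Type*} [CommSemiring R]

lemma sumLen_congr {n : ℕ} {F G : List Bool → R} (h : ∀ w, w.length = n → F w = G w) :
    sumLen n F = sumLen n G :=
  Finset.sum_congr rfl fun f _ => h _ (by simp)

lemma sumLen_mono {n : ℕ} {F G : List Bool → ℝ≥0} (h : ∀ w, w.length = n → F w ≤ G w) :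
    sumLen n F ≤ sumLen n G :=
  Finset.sum_le_sum fun f _ => h _ (by simp)

lemma sumLen_const (n : ℕ) (c : R) : sumLen n (fun _ => c) = 2 ^ n * c := by
  simp [sumLen]

lemma sumLen_mul_left (n : ℕ) (c : R) (F : List Bool → R) :
    sumLen n (fun w => c * F w) = c * sumLen n F := by
  simp [sumLen, Finset.mul_sum]

lemma sumLen_sum {ι : Type*} (n : ℕ) (s : Finset ι) (F : ι → List Bool → R) :
    sumLen n (fun w => ∑ i ∈ s, F i w) = ∑ i ∈ s, sumLen n (F i) :=
  Finset.sum_comm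

lemma sumLen_take_drop (a b : ℕ) (F G : List Bool → R) :
    sumLen (a + b) (fun w => F (w.take a) * G (w.drop a)) = sumLen a F * sumLen b G := by
  simp only [sumLen]
  rw [Finset.sum_mul_sum, ← Fintype.sum_prod_type',
    ← (Fin.appendEquiv a b).sum_comp]
  refine Finset.sum_congr rfl fun f _ => ?_
  simp only [Fin.appendEquiv, Equiv.coe_fn_mk, List.ofFn_fin_append]
  rw [List.take_left' (by simp), List.drop_left' (by simp)]

lemma sumLen_take (a b : ℕ) (F : List Bool → R) :
    sumLen (a + b) (fun w => F (w.take a)) = sumLen a F * 2 ^ b := by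
  simpa [sumLen_const] using sumLen_take_drop a b F fun _ => 1

lemma sumLen_drop (a b : ℕ) (G : List Bool → R) :
    sumLen (a + b) (fun w => G (w.drop a)) = 2 ^ a * sumLen b G := by
  simpa [sumLen_const] using sumLen_take_drop a b (fun _ => 1) G

lemma sumLen_succ (n : ℕ) (F : List Bool → R) :
    sumLen (n + 1) F = sumLen n (fun w => F (false :: w)) + sumLen n (fun w => F (true :: w)) := by
  simp only [sumLen]
  rw [← (Fin.consEquiv fun _ => Bool).sum_comp, ← Finset.univ_product_univ, Finset.sum_product]
  simp [Fin.consEquiv, add_comm]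

lemma sumLen_conv (n : ℕ) (A B : List Bool → R) :
    sumLen n (conv A B) = ∑ i ∈ Finset.range (n + 1), sumLen i A * sumLen (n - i) B := by
  rw [sumLen_congr (G := fun w => ∑ i ∈ Finset.range (n + 1), A (w.take i) * B (w.drop i))
    fun w hw => by rw [conv_eq_sum, hw], sumLen_sum]
  refine Finset.sum_congr rfl fun i hi => ?_
  rw [← sumLen_take_drop, Nat.add_sub_cancel' (Nat.lt_succ_iff.1 (Finset.mem_range.1 hi))]

end SumLen

/-! ### Words of a Poisson number of independent letters -/

/-- The weight of a word for two independent Poisson processes with total masses `c false` and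
`c true`, up to the normalising factor. -/
noncomputable def flat (c : Bool → ℝ≥0) (w : List Bool) : ℝ≥0 :=
  (w.map c).prod / w.length.factorial

lemma flat_const (c : ℝ≥0) (w : List Bool) :
    flat (fun _ => c) w = c ^ w.length / w.length.factorial := by
  simp [flat]

lemma flat_mono {c d : Bool → ℝ≥0} (h : ∀ l, c l ≤ d l) (w : List Bool) : flat c w ≤ flat d w := by
  unfold flat
  gcongr
  induction w with
  | nil => simp
  | cons l w ih => simpa using mul_le_mul' (h l) ih

lemma flat_smul (t : ℝ≥0) (c : Bool → ℝ≥0) (w : List Bool) :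
    flat (fun l => t * c l) w = t ^ w.length * flat c w := by
  unfold flat
  rw [← mul_div_assoc]
  congr 1
  induction w with
  | nil => simp
  | cons l w ih => simp only [List.map_cons, List.prod_cons, List.length_cons, ih]; ring

lemma sumLen_flat (n : ℕ) (c : Bool → ℝ≥0) :
    sumLen n (flat c) = (c false + c true) ^ n / n.factorial := by
  have h : ∀ n, sumLen n (fun w => (w.map c).prod) = (c false + c true) ^ n := by
    intro n
    induction n with
    | zero => simp [sumLen]
    | succ n ih => simp only [sumLen_succ, List.map_cons, List.prod_cons, sumLen_mul_left, ih]; ring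
  rw [sumLen_congr (G := fun w => ((n.factorial : ℝ≥0))⁻¹ * (w.map c).prod) fun w hw => by
    simp [flat, hw, div_eq_inv_mul], sumLen_mul_left, h, div_eq_inv_mul]

/-- The binomial theorem: two adjacent intervals with equal rates for both letters merge into one.
-/
lemma conv_flat_const (c d : ℝ≥0) :
    conv (flat fun _ => c) (flat fun _ => d) = flat fun _ => c + d := by
  funext w
  rw [conv_eq_sum, flat_const, add_pow, Finset.sum_div]
  refine Finset.sum_congr rfl fun i hi => ?_
  have hi' := Nat.lt_succ_iff.1 (Finset.mem_range.1 hi)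
  rw [flat_const, flat_const, List.length_take, List.length_drop, min_eq_left hi',
    Nat.cast_choose ℝ≥0 hi']
  have := Nat.factorial_ne_zero w.length
  field_simp

/-! ### Second moments of likelihood ratios -/

/-- The second moment of the likelihood ratio of `P` with respect to `Q`. -/
noncomputable def chi (P Q : List Bool → ℝ≥0) : ℝ≥0∞ := ∑' w, ((P w ^ 2 / Q w : ℝ≥0) : ℝ≥0∞)

/-- Cauchy-Schwarz over the splittings of `w`; this is the data-processing inequality for forgetting
where the word is cut. -/
lemma conv_sq_div_le (A B Q R : List Bool → ℝ≥0) (hQ : ∀ u, 0 < Q u) (hR : ∀ u, 0 < R u)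
    (w : List Bool) :
    conv A B w ^ 2 / conv Q R w ≤ conv (fun u => A u ^ 2 / Q u) (fun u => B u ^ 2 / R u) w := by
  have hpos : 0 < conv Q R w := by
    rw [conv_eq_sum]
    exact Finset.sum_pos (fun i _ => mul_pos (hQ _) (hR _)) ⟨0, by simp⟩
  rw [div_le_iff₀ hpos]
  simp only [conv_eq_sum]
  refine Finset.sum_sq_le_sum_mul_sum_of_sq_le_mul _ (by simp) (by simp) fun i _ => le_of_eq ?_
  have h1 := (hQ (w.take i)).ne'
  have h2 := (hR (w.drop i)).ne'
  field_simp

lemma tsum_conv (A B : List Bool → ℝ≥0∞) : ∑' w, conv A B w = (∑' w, A w) * ∑' w, B w := by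
  have h : ∀ n, sumLen n (conv A B) =
      ∑ p ∈ Finset.HasAntidiagonal.antidiagonal n, sumLen p.1 A * sumLen p.2 B := fun n => by
    rw [sumLen_conv, Finset.Nat.sum_antidiagonal_eq_sum_range_succ_mk]
  rw [tsum_list_eq, tsum_list_eq, tsum_list_eq, ← ENNReal.tsum_mul_right]
  simp_rw [← ENNReal.tsum_mul_left, h]
  rw [← ENNReal.tsum_prod, ← Finset.HasAntidiagonal.sigmaAntidiagonalEquivProd.tsum_eq, ENNReal.tsum_sigma']
  refine tsum_congr fun n => ?_
  rw [tsum_fintype]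
  exact (Finset.sum_coe_sort _ (fun p : ℕ × ℕ => sumLen p.1 A * sumLen p.2 B)).symm

lemma chi_conv_le (A B Q R : List Bool → ℝ≥0) (hQ : ∀ u, 0 < Q u) (hR : ∀ u, 0 < R u) :
    chi (conv A B) (conv Q R) ≤ chi A Q * chi B R := by
  unfold chi
  rw [← tsum_conv]
  refine ENNReal.tsum_le_tsum fun w => ?_
  refine le_of_le_of_eq ?_ (map_conv ENNReal.ofNNRealHom _ _ w)
  exact ENNReal.coe_le_coe.2 (conv_sq_div_le A B Q R hQ hR w)

lemma convFold_replicate_flat (c : ℝ≥0) (k : ℕ) :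
    convFold (List.replicate (k + 1) (flat fun _ => c)) = flat fun _ => (k + 1) * c := by
  induction k with
  | zero => simp [convFold, conv_convOne]
  | succ k ih =>
    rw [List.replicate_succ, convFold, List.foldr_cons]
    rw [convFold] at ih
    rw [ih, conv_flat_const]
    congr 1
    funext _
    push_cast
    ring

lemma flat_pos {c : ℝ≥0} (hc : 0 < c) (w : List Bool) : 0 < flat (fun _ => c) w := by
  rw [flat_const]
  positivity

/-- The count is `k + 1` because `chi_conv_le` needs positive reference weights, whereas the empty
convolution vanishes on nonempty words. -/
lemma chi_convFold_le (A : List Bool → ℝ≥0) {c : ℝ≥0} (hc : 0 < c) (k : ℕ) :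
    chi (convFold (List.replicate (k + 1) A)) (flat fun _ => (k + 1) * c) ≤
      chi A (flat fun _ => c) ^ (k + 1) := by
  rw [← convFold_replicate_flat]
  induction k with
  | zero => simp [convFold, conv_convOne]
  | succ k ih =>
    rw [List.replicate_succ, List.replicate_succ (n := k + 1), convFold, convFold,
      List.foldr_cons, List.foldr_cons, pow_succ']
    refine (chi_conv_le _ _ _ _ (flat_pos hc) fun u => ?_).trans (mul_le_mul_right ih _)
    have := congrFun (convFold_replicate_flat c k) u
    rw [convFold] at this
    rw [this]
    exact flat_pos (by positivity) u

/-! ### The word of a mini-bucket -/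

lemma conv_pow_length_mul (t : ℝ≥0) (A B : List Bool → ℝ≥0) (w : List Bool) :
    conv (fun u => t ^ u.length * A u) (fun u => t ^ u.length * B u) w =
      t ^ w.length * conv A B w := by
  rw [conv_eq_sum, conv_eq_sum, Finset.mul_sum]
  refine Finset.sum_congr rfl fun i hi => ?_
  have hi' := Nat.lt_succ_iff.1 (Finset.mem_range.1 hi)
  rw [List.length_take, List.length_drop, min_eq_left hi', mul_mul_mul_comm, ← pow_add,
    Nat.add_sub_cancel' hi']

/-- Masses of `p` and `q` on the first and on the last quarter of a mini-bucket of mass `1`. -/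
noncomputable def outerMass (l : Bool) : ℝ≥0 := if l then 1 / 2 else 0

/-- Masses of `p` and `q` on the middle half of a mini-bucket of mass `1`. -/
noncomputable def middleMass (l : Bool) : ℝ≥0 := if l then 0 else 1

/-- The weight of the word of a mini-bucket of mass `1`. -/
noncomputable def miniWeight : List Bool → ℝ≥0 :=
  conv (flat outerMass) (conv (flat middleMass) (flat outerMass))

lemma miniWeight_smul (t : ℝ≥0) (w : List Bool) :
    conv (flat fun l => t * outerMass l)
      (conv (flat fun l => t * middleMass l) (flat fun l => t * outerMass l)) w =
      t ^ w.length * miniWeight w := by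
  have h1 : (flat fun l => t * outerMass l) = fun u => t ^ u.length * flat outerMass u :=
    funext fun u => flat_smul t outerMass u
  have h2 : (flat fun l => t * middleMass l) = fun u => t ^ u.length * flat middleMass u :=
    funext fun u => flat_smul t middleMass u
  have h3 : conv (flat fun l => t * middleMass l) (flat fun l => t * outerMass l) =
      fun u => t ^ u.length * conv (flat middleMass) (flat outerMass) u := by
    rw [h1, h2]
    exact funext fun u => conv_pow_length_mul t _ _ u
  rw [h3, h1, conv_pow_length_mul, miniWeight]

/-- The likelihood ratio, for the word of a mini-bucket, between the two values of the bit. -/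
noncomputable def miniRatio (w : List Bool) : ℝ≥0 := w.length.factorial * miniWeight w

/-- Raising the masses of both letters to `1 / 2`, `1`, `1 / 2` on the three pieces makes them flat,
with total mass `2` per letter. -/
lemma miniRatio_le (w : List Bool) : miniRatio w ≤ 2 ^ w.length := by
  have h1 : ∀ u, flat outerMass u ≤ flat (fun _ => 1 / 2) u := flat_mono fun l => by
    cases l <;> simp [outerMass]
  have h2 : ∀ u, flat middleMass u ≤ flat (fun _ => 1) u := flat_mono fun l => by
    cases l <;> simp [middleMass]
  have h : miniWeight w ≤ flat (fun _ => 2) w := by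
    refine (conv_mono h1 (conv_mono h2 h1) w).trans_eq ?_
    rw [conv_flat_const, conv_flat_const, show (1 / 2 + (1 + 1 / 2) : ℝ≥0) = 2 by norm_num]
  rw [flat_const, le_div_iff₀ (by positivity)] at h
  rwa [miniRatio, mul_comm]

/-- Summing over all words of a given length only sees the combined mass of `p` and `q` on each
piece, and this is the same as under the uniform law. Hence the ratio has mean `1` under uniform
letters. -/
lemma sumLen_miniRatio (n : ℕ) : sumLen n miniRatio = 2 ^ n := by
  have h1 : ∀ i, sumLen i (flat outerMass) = sumLen i (flat fun _ => 1 / 4) := fun i => by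
    rw [sumLen_flat, sumLen_flat]
    norm_num [outerMass]
  have h2 : ∀ i, sumLen i (flat middleMass) = sumLen i (flat fun _ => 1 / 2) := fun i => by
    rw [sumLen_flat, sumLen_flat]
    norm_num [middleMass]
  have h : sumLen n miniWeight = sumLen n (flat fun _ => 1) := by
    rw [show (1 : ℝ≥0) = 1 / 4 + (1 / 2 + 1 / 4) by norm_num, ← conv_flat_const,
      ← conv_flat_const, miniWeight]
    simp only [sumLen_conv, h1, h2]
  rw [sumLen_congr (G := fun w => (n.factorial : ℝ≥0) * miniWeight w) fun w hw => by
    rw [miniRatio, hw], sumLen_mul_left, h, sumLen_flat]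
  have := Nat.factorial_ne_zero n
  field_simp
  norm_num

/-- This is the purpose of the quarter-half-quarter design: words of at most two letters carry no
information, so three draws in a mini-bucket are needed. -/
lemma miniRatio_eq_one {w : List Bool} (hw : w.length ≤ 2) : miniRatio w = 1 := by
  match w with
  | [] => simp [miniRatio, miniWeight, conv, flat]
  | [a] =>
    cases a <;> simp [miniRatio, miniWeight, conv, flat, outerMass, middleMass]
    rw [← two_mul, mul_inv_cancel₀ two_ne_zero]
  | [a, b] =>
    cases a <;> cases b
    all_goals simp [miniRatio, miniWeight, conv, flat, outerMass, middleMass]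
    all_goals norm_num [Nat.factorial]
  | _ :: _ :: _ :: _ => simp at hw

/-! ### Second moment of the likelihood ratio of a macro-bucket -/

section SecondMoment

variable {H : List Bool → ℝ≥0}

lemma sumLen_factor (hsum : ∀ j, sumLen j H = 2 ^ j) {n i j : ℕ} (h : i + j ≤ n) :
    sumLen n (fun w => H ((w.drop i).take j)) = 2 ^ n := by
  obtain ⟨r, rfl⟩ := Nat.exists_eq_add_of_le h
  rw [add_assoc, sumLen_drop i (j + r) fun v => H (v.take j), sumLen_take, hsum]
  ring

/-- Disjoint blocks of a uniform word are independent, so the mean of the product is the product of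
the means. -/
lemma sumLen_two_factors (hsum : ∀ j, sumLen j H = 2 ^ j) {n i j i' j' : ℕ} (h : i + j ≤ i')
    (h' : i' + j' ≤ n) :
    sumLen n (fun w => H ((w.drop i).take j) * H ((w.drop i').take j')) = 2 ^ n := by
  obtain ⟨s, rfl⟩ := Nat.exists_eq_add_of_le h
  obtain ⟨r, rfl⟩ := Nat.exists_eq_add_of_le h'
  have := sumLen_take_drop (i + j) (s + j' + r) (fun u => H ((u.drop i).take j))
    fun v => H ((v.drop s).take j')
  rw [sumLen_factor hsum le_rfl, sumLen_factor hsum (Nat.le_add_right _ _), ← pow_add] at this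
  rw [show i + j + s + j' + r = i + j + (s + j' + r) by ring, ← this]
  refine sumLen_congr fun w _ => ?_
  rw [List.drop_drop, List.drop_take, List.take_take]
  simp

/-- A short block contributes the factor `1` and disjoint blocks are uncorrelated. Only overlapping
blocks with at least three letters each need the crude pointwise bound. -/
lemma sumLen_factors_le (hle : ∀ v, H v ≤ 2 ^ v.length) (hsum : ∀ j, sumLen j H = 2 ^ j)
    (hone : ∀ v, v.length ≤ 2 → H v = 1) {n i j i' j' : ℕ} (h : i + j ≤ n) (h' : i' + j' ≤ n) :
    sumLen n (fun w => H ((w.drop i).take j) * H ((w.drop i').take j')) ≤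
      2 ^ n * (1 + if 3 ≤ j ∧ 3 ≤ j' ∧ i' < i + j ∧ i < i' + j' then 2 ^ (j + j') else 0) := by
  have hlen : ∀ w : List Bool, ∀ i j, ((w.drop i).take j).length ≤ j := fun w i j => by simp
  by_cases hj : 3 ≤ j
  swap
  · have e : ∀ w : List Bool, H ((w.drop i).take j) = 1 := fun w =>
      hone _ ((hlen _ _ j).trans (by omega))
    simp only [e, one_mul, sumLen_factor hsum h']
    exact le_mul_of_one_le_right' (by simp)
  by_cases hj' : 3 ≤ j'
  swap
  · have e : ∀ w : List Bool, H ((w.drop i').take j') = 1 := fun w =>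
      hone _ ((hlen _ _ j').trans (by omega))
    simp only [e, mul_one, sumLen_factor hsum h]
    exact le_mul_of_one_le_right' (by simp)
  by_cases h1 : i + j ≤ i'
  · rw [sumLen_two_factors hsum h1 h']
    exact le_mul_of_one_le_right' (by simp)
  by_cases h2 : i' + j' ≤ i
  · rw [sumLen_congr fun w _ => mul_comm _ _]
    rw [sumLen_two_factors hsum h2 h]
    exact le_mul_of_one_le_right' (by simp)
  rw [if_pos ⟨hj, hj', by omega, by omega⟩]
  have hle' : ∀ w : List Bool, ∀ i j, H ((w.drop i).take j) ≤ 2 ^ j := fun w i j =>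
    (hle _).trans (pow_le_pow_right₀ one_le_two (hlen w i j))
  refine (sumLen_mono (G := fun _ => 2 ^ (j + j')) fun w _ => ?_).trans ?_
  · rw [pow_add]
    exact mul_le_mul' (hle' _ _ _) (hle' _ _ _)
  · rw [sumLen_const]
    gcongr
    exact le_add_self

/-- The positions of a block of `p.1` letters, starting at `p.2`, in a word of length `n`. -/
def blocks (n : ℕ) : Finset (Σ _ : ℕ, ℕ) :=
  (Finset.range (n + 1)).sigma fun j => Finset.range (n - j + 1)

lemma mem_blocks {n : ℕ} {p : Σ _ : ℕ, ℕ} : p ∈ blocks n ↔ p.2 + p.1 ≤ n := by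
  simp only [blocks, Finset.mem_sigma, Finset.mem_range]
  omega

lemma sum_blocks {R : Type*} [AddCommMonoid R] (n : ℕ) (f : ℕ → ℕ → R) :
    ∑ p ∈ blocks n, f p.1 p.2 =
      ∑ j ∈ Finset.range (n + 1), ∑ i ∈ Finset.range (n - j + 1), f j i := by
  rw [blocks, Finset.sum_sigma]

/-- The binomial probability of `j` of `n` draws falling into the mini-bucket. -/
noncomputable def binomWeight (ε δ : ℝ≥0) (n j : ℕ) : ℝ≥0 := n.choose j * ε ^ j * δ ^ (n - j)

/-- The likelihood ratio for the word of a macro-bucket whose mini-bucket has relative mass `ε`. -/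
noncomputable def macroRatio (H : List Bool → ℝ≥0) (ε δ : ℝ≥0) (w : List Bool) : ℝ≥0 :=
  ∑ p ∈ blocks w.length, binomWeight ε δ w.length p.1 / (w.length - p.1 + 1 : ℕ) *
    H ((w.drop p.2).take p.1)

/-- The weights form a probability distribution on blocks: binomial length, then uniform start. -/
lemma sum_binomWeight {ε δ : ℝ≥0} (h : ε + δ = 1) (n : ℕ) :
    ∑ p ∈ blocks n, binomWeight ε δ n p.1 / (n - p.1 + 1 : ℕ) = 1 := by
  rw [sum_blocks n fun j _ => binomWeight ε δ n j / (n - j + 1 : ℕ)]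
  have : ∀ j, ∑ _i ∈ Finset.range (n - j + 1), binomWeight ε δ n j / (n - j + 1 : ℕ) =
      ε ^ j * δ ^ (n - j) * n.choose j := fun j => by
    rw [Finset.sum_const, Finset.card_range, nsmul_eq_mul, mul_div_cancel₀ _ (by positivity),
      binomWeight]
    ring
  simp_rw [this]
  rw [← add_pow, h, one_pow]

/-- Since `n.choose j ≤ n ^ 3 * (n - 3).choose (j - 3)`, the tail is `(n y) ^ 3` times a binomial
expansion of exponent `n - 3`. -/
lemma sum_choose_tail_le (n : ℕ) (y : ℝ≥0) :
    ∑ j ∈ Finset.range (n + 1), (if 3 ≤ j then (n.choose j : ℝ≥0) * y ^ j else 0) ≤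
      (n : ℝ≥0) ^ 3 * y ^ 3 * (1 + y) ^ n := by
  rcases lt_or_ge n 3 with hn | hn
  · rw [Finset.sum_eq_zero]
    · simp
    · intro j hj
      rw [if_neg]
      have := Finset.mem_range.1 hj
      omega
  obtain ⟨m, rfl⟩ := Nat.exists_eq_add_of_le' hn
  rw [show m + 3 + 1 = (m + 1) + 1 + 1 + 1 by ring, Finset.sum_range_succ', Finset.sum_range_succ',
    Finset.sum_range_succ']
  simp only [le_add_iff_nonneg_left, zero_le, if_true, zero_add, Nat.reduceAdd, Nat.reduceLeDiff,
    if_false, add_zero, add_assoc]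
  have hch : ∀ j, ((m + 3).choose (j + 3) : ℝ≥0) ≤ ((m + 3 : ℕ) : ℝ≥0) ^ 3 * m.choose j := by
    intro j
    have h1 : ∀ a b : ℕ, (a + 1).choose (b + 1) ≤ (a + 1) * a.choose b := fun a b => by
      have := Nat.add_one_mul_choose_eq a b
      calc _ ≤ (a + 1).choose (b + 1) * (b + 1) := Nat.le_mul_of_pos_right _ (by omega)
        _ = _ := this.symm
    have : (m + 3).choose (j + 3) ≤ (m + 3) ^ 3 * m.choose j := by
      calc _ ≤ (m + 3) * ((m + 2) * ((m + 1) * m.choose j)) :=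
            (h1 _ _).trans (Nat.mul_le_mul_left _ ((h1 _ _).trans
              (Nat.mul_le_mul_left _ (h1 _ _))))
        _ ≤ (m + 3) * ((m + 3) * ((m + 3) * m.choose j)) := by gcongr <;> omega
        _ = _ := by ring
    exact_mod_cast this
  calc ∑ j ∈ Finset.range (m + 1), ((m + 3).choose (j + 3) : ℝ≥0) * y ^ (j + 3)
      ≤ ∑ j ∈ Finset.range (m + 1), ((m + 3 : ℕ) : ℝ≥0) ^ 3 * y ^ 3 * (y ^ j * 1 ^ (m - j) *
          m.choose j) := by
        refine Finset.sum_le_sum fun j _ => ?_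
        calc _ ≤ ((m + 3 : ℕ) : ℝ≥0) ^ 3 * m.choose j * y ^ (j + 3) := by gcongr; exact hch j
          _ = _ := by ring
    _ = ((m + 3 : ℕ) : ℝ≥0) ^ 3 * y ^ 3 * (1 + y) ^ m := by
        rw [← Finset.mul_sum, ← add_pow, add_comm y]
    _ ≤ _ := by
        gcongr
        · exact le_self_add
        · omega

/-- Replaces the number of starting positions by `n` at the price of a factor `j`, which exponential
weights in `j` absorb. -/
lemma inv_sub_add_one_le {n j : ℕ} (hj : 1 ≤ j) (hjn : j ≤ n) :
    ((n - j + 1 : ℕ) : ℝ≥0)⁻¹ ≤ j / n := by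
  rw [le_div_iff₀ (by exact_mod_cast hj.trans hjn), inv_mul_le_iff₀ (by positivity)]
  obtain ⟨a, rfl⟩ := Nat.exists_eq_add_of_le' hj
  obtain ⟨b, rfl⟩ := Nat.exists_eq_add_of_le' hjn
  norm_cast
  simp only [Nat.add_sub_cancel]
  nlinarith

lemma card_overlap_le (n i j j' : ℕ) :
    ((Finset.range n).filter fun i' => i' < i + j ∧ i < i' + j').card ≤ j + j' := by
  refine (Finset.card_le_card (t := Finset.Ico (i - j') (i + j)) fun i' hi' => ?_).trans ?_
  · simp only [Finset.mem_filter, Finset.mem_Ico] at hi' ⊢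
    omega
  · rw [Nat.card_Ico]
    omega

lemma sum_overlap_le (ε δ : ℝ≥0) (hδ : δ ≤ 1) (n : ℕ) :
    ∑ p ∈ blocks n, ∑ p' ∈ blocks n,
      binomWeight ε δ n p.1 / (n - p.1 + 1 : ℕ) * (binomWeight ε δ n p'.1 / (n - p'.1 + 1 : ℕ)) *
        (if 3 ≤ p.1 ∧ 3 ≤ p'.1 ∧ p'.2 < p.2 + p.1 ∧ p.2 < p'.2 + p'.1 then 2 ^ (p.1 + p'.1) else 0) ≤
      8 ^ 6 * (n : ℝ≥0) ^ 5 * ε ^ 6 * (1 + 8 * ε) ^ (2 * n) := by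
  set b := binomWeight ε δ n with hb
  -- The base `8 = 2 * 2 * 2` pays for three factors, each at most `2 ^ (j + j')`: the number of
  -- overlapping starts, the `j'` from `inv_sub_add_one_le`, and the pointwise bound on the two
  -- ratios.
  set g : ℕ → ℝ≥0 := fun j => if 3 ≤ j then b j * 8 ^ j else 0 with hg
  have hinner : ∀ j i j', j' ∈ Finset.range (n + 1) →
      ∑ i' ∈ Finset.range (n - j' + 1), b j / (n - j + 1 : ℕ) * (b j' / (n - j' + 1 : ℕ)) *
        (if 3 ≤ j ∧ 3 ≤ j' ∧ i' < i + j ∧ i < i' + j' then 2 ^ (j + j') else 0) ≤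
      (g j / (n - j + 1 : ℕ)) * (g j' / n) := by
    intro j i j' hj'mem
    have hj'n := Nat.lt_succ_iff.1 (Finset.mem_range.1 hj'mem)
    by_cases hj : 3 ≤ j
    swap
    · simp [hj]
    by_cases hj' : 3 ≤ j'
    swap
    · simp [hj']
    simp only [hj, hj', true_and, hg, if_true]
    rw [← Finset.mul_sum, ← Finset.sum_filter, Finset.sum_const, nsmul_eq_mul]
    have hc : (((Finset.range (n - j' + 1)).filter fun i' => i' < i + j ∧ i < i' + j').card : ℝ≥0)
        ≤ (j + j' : ℕ) := by exact_mod_cast card_overlap_le _ i j j'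
    have h2 : ((j + j' : ℕ) : ℝ≥0) * j' * 2 ^ (j + j') ≤ 8 ^ j * 8 ^ j' := by
      have e1 : j + j' ≤ 2 ^ (j + j') := Nat.lt_two_pow_self.le
      have e2 : j' ≤ 2 ^ (j + j') := by omega
      have : (j + j') * j' * 2 ^ (j + j') ≤ 8 ^ j * 8 ^ j' := by
        calc _ ≤ 2 ^ (j + j') * 2 ^ (j + j') * 2 ^ (j + j') := by gcongr
          _ = (2 * 2 * 2) ^ (j + j') := by rw [mul_pow, mul_pow]
          _ = _ := by norm_num [pow_add]
      exact_mod_cast this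
    calc _ ≤ b j / (n - j + 1 : ℕ) * (b j' * (j' / n)) * ((j + j' : ℕ) * 2 ^ (j + j')) := by
          gcongr
          rw [div_eq_mul_inv]
          gcongr
          exact inv_sub_add_one_le (by omega) hj'n
      _ = b j / (n - j + 1 : ℕ) * (b j' / n) * ((j + j' : ℕ) * j' * 2 ^ (j + j')) := by
          rw [mul_div_assoc', mul_div_assoc', mul_div_assoc', div_mul_eq_mul_div,
            div_mul_eq_mul_div]
          ring
      _ ≤ b j / (n - j + 1 : ℕ) * (b j' / n) * (8 ^ j * 8 ^ j') := by gcongr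
      _ = _ := by
          rw [div_mul_div_comm, div_mul_div_comm, div_mul_eq_mul_div]
          congr 1
          ring
  have hG : ∑ j ∈ Finset.range (n + 1), g j ≤
      (n : ℝ≥0) ^ 3 * (8 * ε) ^ 3 * (1 + 8 * ε) ^ n := by
    refine (Finset.sum_le_sum fun j _ => ?_).trans (sum_choose_tail_le n (8 * ε))
    simp only [hg]
    split_ifs
    · rw [hb, binomWeight, mul_pow]
      calc (n.choose j : ℝ≥0) * ε ^ j * δ ^ (n - j) * 8 ^ j
          ≤ n.choose j * ε ^ j * 1 * 8 ^ j := by gcongr; exact pow_le_one₀ zero_le hδ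
        _ = _ := by ring
    · exact le_rfl
  calc _ ≤ ∑ p ∈ blocks n, g p.1 / (n - p.1 + 1 : ℕ) *
          ((∑ j ∈ Finset.range (n + 1), g j) / n) := by
        refine Finset.sum_le_sum fun p _ => ?_
        rw [sum_blocks n fun j' i' =>
          b p.1 / (n - p.1 + 1 : ℕ) * (b j' / (n - j' + 1 : ℕ)) *
          (if 3 ≤ p.1 ∧ 3 ≤ j' ∧ i' < p.2 + p.1 ∧ p.2 < i' + j' then 2 ^ (p.1 + j') else 0),
          Finset.sum_div, Finset.mul_sum]
        exact Finset.sum_le_sum fun j' hj' => hinner p.1 p.2 j' hj'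
    -- The first block keeps its exact factor `1 / (n - j + 1)`, which cancels against its number of
    -- starting positions. Only the second block produces the `1 / n`.
    _ = (∑ j ∈ Finset.range (n + 1), g j) ^ 2 / n := by
        rw [← Finset.sum_mul, sum_blocks n fun j _ => g j / (n - j + 1 : ℕ)]
        simp only [Finset.sum_const, Finset.card_range, nsmul_eq_mul]
        rw [Finset.sum_congr rfl fun j _ => mul_div_cancel₀ (g j) (by positivity)]
        ring
    _ ≤ ((n : ℝ≥0) ^ 3 * (8 * ε) ^ 3 * (1 + 8 * ε) ^ n) ^ 2 / n := by gcongr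
    _ = _ := by
        rcases Nat.eq_zero_or_pos n with rfl | hn
        · simp
        · have : (n : ℝ≥0) ≠ 0 := by positivity
          field_simp
          ring

lemma sumLen_macroRatio_sq_le (hle : ∀ v, H v ≤ 2 ^ v.length) (hsum : ∀ j, sumLen j H = 2 ^ j)
    (hone : ∀ v, v.length ≤ 2 → H v = 1) {ε δ : ℝ≥0} (h : ε + δ = 1) (n : ℕ) :
    sumLen n (fun w => macroRatio H ε δ w ^ 2) ≤
      2 ^ n * (1 + 8 ^ 6 * (n : ℝ≥0) ^ 5 * ε ^ 6 * (1 + 8 * ε) ^ (2 * n)) := by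
  set a : ℕ → ℝ≥0 := fun j => binomWeight ε δ n j / (n - j + 1 : ℕ) with ha
  -- The square of an average over blocks is an average over pairs of independent blocks.
  have h1 : sumLen n (fun w => macroRatio H ε δ w ^ 2) =
      ∑ p ∈ blocks n, ∑ p' ∈ blocks n, a p.1 * a p'.1 *
        sumLen n (fun w => H ((w.drop p.2).take p.1) * H ((w.drop p'.2).take p'.1)) := by
    simp_rw [← sumLen_mul_left, ← sumLen_sum]
    refine sumLen_congr fun w hw => ?_
    rw [macroRatio, hw, sq, Finset.sum_mul_sum]
    exact Finset.sum_congr rfl fun p _ => Finset.sum_congr rfl fun p' _ => by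
      simp only [ha]; ring
  rw [h1]
  calc _ ≤ ∑ p ∈ blocks n, ∑ p' ∈ blocks n, a p.1 * a p'.1 * (2 ^ n * (1 +
        if 3 ≤ p.1 ∧ 3 ≤ p'.1 ∧ p'.2 < p.2 + p.1 ∧ p.2 < p'.2 + p'.1 then
          2 ^ (p.1 + p'.1) else 0)) := by
        refine Finset.sum_le_sum fun p hp => Finset.sum_le_sum fun p' hp' => ?_
        gcongr
        exact sumLen_factors_le hle hsum hone (mem_blocks.1 hp) (mem_blocks.1 hp')
    _ = 2 ^ n * ((∑ p ∈ blocks n, a p.1) * (∑ p ∈ blocks n, a p.1) +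
          ∑ p ∈ blocks n, ∑ p' ∈ blocks n, a p.1 * a p'.1 *
            if 3 ≤ p.1 ∧ 3 ≤ p'.1 ∧ p'.2 < p.2 + p.1 ∧ p.2 < p'.2 + p'.1 then
              2 ^ (p.1 + p'.1) else 0) := by
        rw [Finset.sum_mul_sum, mul_add, Finset.mul_sum, Finset.mul_sum, ← Finset.sum_add_distrib]
        refine Finset.sum_congr rfl fun p _ => ?_
        rw [Finset.mul_sum, Finset.mul_sum, ← Finset.sum_add_distrib]
        exact Finset.sum_congr rfl fun p' _ => by ring
    _ ≤ _ := by
        rw [sum_binomWeight h, one_mul]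
        gcongr
        exact sum_overlap_le ε δ (h ▸ le_add_self) n

end SecondMoment

/-- The weight of the word of a macro-bucket of mass `t`, averaged over the position of the
mini-bucket of relative mass `ε`, up to the normalising factor. -/
noncomputable def macroWeight (t ε δ : ℝ≥0) (w : List Bool) : ℝ≥0 :=
  ∑ p ∈ blocks w.length, (t * δ) ^ (w.length - p.1) / (w.length - p.1 + 1).factorial *
    (t * ε) ^ p.1 * miniWeight ((w.drop p.2).take p.1)

/-- The factorials recombine: `n! / (j! (n - j + 1)!)` is `n.choose j / (n - j + 1)`, the binomial
weight times the uniform weight of a start. -/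
lemma macroWeight_eq (t ε δ : ℝ≥0) (w : List Bool) :
    macroWeight t ε δ w = flat (fun _ => t) w * macroRatio miniRatio ε δ w := by
  rw [macroWeight, macroRatio, Finset.mul_sum]
  refine Finset.sum_congr rfl fun p hp => ?_
  have hp' := mem_blocks.1 hp
  have hj : p.1 ≤ w.length := by omega
  have hlen : ((w.drop p.2).take p.1).length = p.1 := by
    rw [List.length_take, List.length_drop]
    omega
  obtain ⟨a, ha⟩ := Nat.exists_eq_add_of_le hj
  rw [miniRatio, hlen, binomWeight, Nat.cast_choose ℝ≥0 hj, flat_const, mul_pow, mul_pow, ha,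
    Nat.add_sub_cancel_left, Nat.factorial_succ, pow_add]
  have h1 := Nat.factorial_ne_zero a
  have h2 := Nat.factorial_ne_zero p.1
  have h3 := Nat.factorial_ne_zero (p.1 + a)
  push_cast
  field_simp

/-! ### Summation over the Poisson number of draws in a macro-bucket. -/

lemma pow_five_le {x t : ℝ} (hx : 0 ≤ x) (ht : 0 < t) :
    x ^ 5 ≤ 120 * t ^ 5 * Real.exp (x / t) := by
  have h := Real.pow_div_factorial_le_exp (x / t) (by positivity) 5
  rw [div_pow, div_div, div_le_iff₀ (by positivity)] at h
  norm_num [Nat.factorial] at h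
  linarith

/-- The constant in the bound on the second moment for one macro-bucket. -/
noncomputable def macroConst : ℝ := 8 ^ 6 * 120 * Real.exp (2 * (17 * Real.exp 17))

/-- Both `n ^ 5 / t ^ 5` and `(1 + 8 ε) ^ (2 n)` are bounded by exponentials in `n`, so they only
change the rate `2 t` of the exponential series. -/
lemma poisson_moment_le {t ε : ℝ} (ht : 1 ≤ t) (hε : 0 ≤ ε) (n : ℕ) :
    (2 * t) ^ n / n.factorial * (1 + 8 ^ 6 * (n : ℝ) ^ 5 * ε ^ 6 * (1 + 8 * ε) ^ (2 * n)) ≤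
      (2 * t) ^ n / n.factorial + 8 ^ 6 * 120 * t ^ 5 * ε ^ 6 *
        ((2 * t * Real.exp (16 * ε + 1 / t)) ^ n / n.factorial) := by
  have h1 : (1 + 8 * ε) ^ (2 * n) ≤ Real.exp (16 * ε) ^ n := by
    rw [pow_mul]
    refine pow_le_pow_left₀ (by positivity) ?_ n
    calc (1 + 8 * ε) ^ 2 ≤ Real.exp (8 * ε) ^ 2 := by
          gcongr
          linarith [Real.add_one_le_exp (8 * ε)]
      _ = _ := by rw [← Real.exp_nat_mul]; congr 1; push_cast; ring
  have h2 : (n : ℝ) ^ 5 ≤ 120 * t ^ 5 * Real.exp (1 / t) ^ n := by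
    have := pow_five_le (Nat.cast_nonneg n) (zero_lt_one.trans_le ht)
    rwa [← Real.exp_nat_mul, mul_one_div]
  have h0 : 0 ≤ t := by linarith
  calc _ = (2 * t) ^ n / n.factorial + (2 * t) ^ n / n.factorial *
        (8 ^ 6 * (n : ℝ) ^ 5 * ε ^ 6 * (1 + 8 * ε) ^ (2 * n)) := by ring
    _ ≤ (2 * t) ^ n / n.factorial + (2 * t) ^ n / n.factorial *
        (8 ^ 6 * (120 * t ^ 5 * Real.exp (1 / t) ^ n) * ε ^ 6 * Real.exp (16 * ε) ^ n) := by
      gcongr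
    _ = _ := by rw [Real.exp_add, mul_pow (2 * t), mul_pow (Real.exp _)]; ring

/-- The changed rate exceeds `2 t` by a bounded amount: with `y = 16 ε + 1 / t`, both `y` and `t y`
are at most `16 + 1 = 17`. -/
lemma exp_moment_le {t ε : ℝ} (ht : 1 ≤ t) (hε : 0 ≤ ε) (hε1 : ε ≤ 1) (htε : t * ε ≤ 1) :
    Real.exp (2 * t) + 8 ^ 6 * 120 * t ^ 5 * ε ^ 6 * Real.exp (2 * t * Real.exp (16 * ε + 1 / t)) ≤
      Real.exp (2 * t) * (1 + macroConst * (t ^ 5 * ε ^ 6)) := by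
  have h0 : 0 < t := by linarith
  set y := 16 * ε + 1 / t with hy
  have hy0 : 0 ≤ y := by positivity
  have hy17 : y ≤ 17 := by
    have : 1 / t ≤ 1 := by rw [div_le_one h0]; exact ht
    linarith
  have hty : t * y ≤ 17 := by
    have : t * y = 16 * (t * ε) + 1 := by rw [hy]; field_simp
    linarith
  -- From `exp y * (1 - y) ≤ 1` one gets `exp y ≤ 1 + y * exp y`, and `y ≤ 17` bounds the last
  -- exponential.
  have hexp : Real.exp y ≤ 1 + y * Real.exp 17 := by
    have h1 : Real.exp y * (1 - y) ≤ 1 := by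
      have := Real.one_sub_le_exp_neg y
      calc _ ≤ Real.exp y * Real.exp (-y) := by gcongr
        _ = 1 := by rw [← Real.exp_add]; simp
    have h2 : Real.exp y ≤ Real.exp 17 := Real.exp_le_exp.2 hy17
    nlinarith
  have hexp' : 2 * t * Real.exp y ≤ 2 * t + 2 * (17 * Real.exp 17) := by
    have := Real.exp_pos 17
    calc 2 * t * Real.exp y ≤ 2 * t * (1 + y * Real.exp 17) := by gcongr
      _ = 2 * t + 2 * ((t * y) * Real.exp 17) := by ring
      _ ≤ _ := by gcongr
  calc _ ≤ Real.exp (2 * t) + 8 ^ 6 * 120 * t ^ 5 * ε ^ 6 *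
        Real.exp (2 * t + 2 * (17 * Real.exp 17)) := by gcongr
    _ = _ := by rw [Real.exp_add, macroConst]; ring

lemma tsum_pow_div_factorial {x : ℝ} (hx : 0 ≤ x) :
    ∑' n : ℕ, ENNReal.ofReal (x ^ n / n.factorial) = ENNReal.ofReal (Real.exp x) := by
  rw [← ENNReal.ofReal_tsum_of_nonneg (fun n => by positivity)
    (Real.summable_pow_div_factorial x), Real.exp_eq_exp_ℝ, NormedSpace.exp_eq_tsum_div]

lemma chi_macroWeight_le {t ε δ : ℝ≥0} (h : ε + δ = 1) (ht : 1 ≤ t) (htε : t * ε ≤ 1) :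
    chi (macroWeight t ε δ) (flat fun _ => t) ≤
      ENNReal.ofReal (Real.exp (2 * t) * (1 + macroConst * ((t : ℝ) ^ 5 * (ε : ℝ) ^ 6))) := by
  have ht0 : 0 < t := zero_lt_one.trans_le ht
  have hε1 : ε ≤ 1 := h ▸ le_self_add
  have hterm : ∀ n, sumLen n (fun w => ((macroWeight t ε δ w ^ 2 / flat (fun _ => t) w : ℝ≥0) :
      ℝ≥0∞)) ≤ ENNReal.ofReal ((2 * t : ℝ) ^ n / n.factorial + 8 ^ 6 * 120 * (t : ℝ) ^ 5 *
        (ε : ℝ) ^ 6 * ((2 * t * Real.exp (16 * ε + 1 / t)) ^ n / n.factorial)) := by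
    intro n
    have h1 : sumLen n (fun w => ((macroWeight t ε δ w ^ 2 / flat (fun _ => t) w : ℝ≥0) : ℝ≥0∞)) =
        ((t ^ n / n.factorial * sumLen n (fun w => macroRatio miniRatio ε δ w ^ 2) : ℝ≥0) :
          ℝ≥0∞) := by
      rw [← sumLen_mul_left, sumLen, sumLen, ENNReal.ofNNReal_finsetSum]
      refine Finset.sum_congr rfl fun f _ => ?_
      have hp := (flat_pos ht0 (List.ofFn f)).ne'
      rw [macroWeight_eq, mul_pow, sq (flat _ _), mul_assoc, mul_div_cancel_left₀ _ hp, flat_const,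
        List.length_ofFn]
    rw [h1, ENNReal.le_ofReal_iff_toReal_le ENNReal.coe_ne_top (by positivity),
      ENNReal.coe_toReal]
    refine le_trans ?_ (poisson_moment_le (by exact_mod_cast ht) ε.coe_nonneg n)
    have h2 : t ^ n / n.factorial * sumLen n (fun w => macroRatio miniRatio ε δ w ^ 2) ≤
        (2 * t) ^ n / n.factorial *
          (1 + 8 ^ 6 * (n : ℝ≥0) ^ 5 * ε ^ 6 * (1 + 8 * ε) ^ (2 * n)) := by
      calc _ ≤ t ^ n / n.factorial * (2 ^ n *
            (1 + 8 ^ 6 * (n : ℝ≥0) ^ 5 * ε ^ 6 * (1 + 8 * ε) ^ (2 * n))) := by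
            gcongr
            exact sumLen_macroRatio_sq_le miniRatio_le sumLen_miniRatio
              (fun _ => miniRatio_eq_one) h n
        _ = _ := by rw [mul_pow]; ring
    exact_mod_cast h2
  rw [chi, tsum_list_eq]
  refine (ENNReal.tsum_le_tsum hterm).trans ?_
  simp_rw [fun n : ℕ => ENNReal.ofReal_add (p := (2 * t : ℝ) ^ n / n.factorial)
    (q := 8 ^ 6 * 120 * (t : ℝ) ^ 5 * (ε : ℝ) ^ 6 *
      ((2 * t * Real.exp (16 * ε + 1 / t)) ^ n / n.factorial)) (by positivity) (by positivity),
    fun n : ℕ => ENNReal.ofReal_mul (p := 8 ^ 6 * 120 * (t : ℝ) ^ 5 * (ε : ℝ) ^ 6)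
      (q := (2 * t * Real.exp (16 * ε + 1 / t)) ^ n / n.factorial) (by positivity)]
  rw [ENNReal.tsum_add, ENNReal.tsum_mul_left, tsum_pow_div_factorial (by positivity),
    tsum_pow_div_factorial (by positivity), ← ENNReal.ofReal_mul (by positivity),
    ← ENNReal.ofReal_add (by positivity) (by positivity)]
  exact ENNReal.ofReal_le_ofReal (exp_moment_le (by exact_mod_cast ht) ε.coe_nonneg
    (by exact_mod_cast hε1) (by exact_mod_cast htε))

/-! ### Iterated integrals over simplices -/

/-- The integral of `∏ i, d (w i) (t i)` over `s < t 0 < t 1 < ⋯ ≤ e`. -/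
noncomputable def iterInt (d : Bool → ℝ → ℝ≥0∞) (e : ℝ) : List Bool → ℝ → ℝ≥0∞
  | [], _ => 1
  | l :: w, s => ∫⁻ t in Ioc s e, d l t * iterInt d e w t

/-- Monotonicity in the lower endpoint gives measurability with no assumption on `d`. -/
lemma measurable_iterInt (d : Bool → ℝ → ℝ≥0∞) (e : ℝ) (w : List Bool) :
    Measurable (iterInt d e w) := by
  cases w with
  | nil => exact measurable_const
  | cons l w =>
    refine Antitone.measurable fun s s' h => ?_
    exact lintegral_mono_set (Ioc_subset_Ioc_left h)

lemma measurable_conv {α : Type*} [MeasurableSpace α] {A B : α → List Bool → ℝ≥0∞}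
    (hA : ∀ u, Measurable fun a => A a u) (hB : ∀ u, Measurable fun a => B a u) (w : List Bool) :
    Measurable fun a => conv (A a) (B a) w := by
  simp only [conv_eq_sum]
  exact Finset.measurable_sum _ fun i _ => (hA _).mul (hB _)

lemma lintegral_conv_left {α : Type*} [MeasurableSpace α] (μ : Measure α)
    {A : α → List Bool → ℝ≥0∞} (hA : ∀ u, Measurable fun a => A a u) (B : List Bool → ℝ≥0∞)
    (w : List Bool) :
    ∫⁻ a, conv (A a) B w ∂μ = conv (fun u => ∫⁻ a, A a u ∂μ) B w := by
  simp only [conv_eq_sum]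
  rw [lintegral_finsetSum _ fun i _ => (hA _).mul_const _]
  exact Finset.sum_congr rfl fun i _ => lintegral_mul_const _ (hA _)

/-- Classify ordered points by how many lie at or before `b`. In the induction, the first point is
either past `b`, so that the left word is empty, or joins the left word. -/
lemma iterInt_split {d : Bool → ℝ → ℝ≥0∞} (hd : ∀ l, Measurable (d l)) {b e : ℝ} (hbe : b ≤ e)
    (w : List Bool) {s : ℝ} (hsb : s ≤ b) :
    iterInt d e w s = conv (fun u => iterInt d b u s) (fun u => iterInt d e u b) w := by
  induction w generalizing s with
  | nil => simp [conv, iterInt]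
  | cons l w ih =>
    rw [conv, show iterInt d e (l :: w) s = ∫⁻ t in Ioc s e, d l t * iterInt d e w t from rfl,
      ← Ioc_union_Ioc_eq_Ioc hsb hbe,
      lintegral_union measurableSet_Ioc (Ioc_disjoint_Ioc_of_le le_rfl), add_comm]
    congr 1
    · simp [iterInt]
    · rw [setLIntegral_congr_fun (g := fun t => conv (fun u => d l t * iterInt d b u t)
        (fun u => iterInt d e u b) w) measurableSet_Ioc fun t ht => by
          simp only [conv_mul_left, ih ht.2]]
      exact lintegral_conv_left _ (fun u => (hd l).mul (measurable_iterInt d b u)) _ w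

lemma iterInt_self (d : Bool → ℝ → ℝ≥0∞) (e : ℝ) (w : List Bool) :
    iterInt d e w e = convOne w := by
  cases w <;> simp [iterInt, convOne]

lemma iterInt_grid {d : Bool → ℝ → ℝ≥0∞} (hd : ∀ l, Measurable (d l)) (g : ℕ → ℝ)
    (hg : Monotone g) (n : ℕ) (w : List Bool) :
    iterInt d (g n) w (g 0) =
      convFold (List.ofFn fun i : Fin n => fun u => iterInt d (g (i + 1)) u (g i)) w := by
  induction n generalizing g w with
  | zero => simp [convFold, iterInt_self]
  | succ n ih =>
    have h := fun u => ih (fun i => g (i + 1)) (fun i j h => hg (by omega)) u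
    rw [iterInt_split hd (hg (show 1 ≤ n + 1 by omega)) w (hg zero_le_one), List.ofFn_succ,
      convFold, List.foldr_cons]
    simp only [zero_add] at h
    congr 1
    funext u
    rw [h, convFold]
    simp

lemma iterInt_congr {d d' : Bool → ℝ → ℝ≥0∞} {s e : ℝ}
    (h : ∀ l, ∀ t ∈ Ioo s e, d l t = d' l t) (w : List Bool) :
    iterInt d e w s = iterInt d' e w s := by
  induction w generalizing s with
  | nil => rfl
  | cons l w ih =>
    rw [iterInt, iterInt, setLIntegral_congr Ioo_ae_eq_Ioc.symm,
      setLIntegral_congr Ioo_ae_eq_Ioc.symm]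
    refine setLIntegral_congr_fun measurableSet_Ioo fun t ht => ?_
    rw [h l t ht, ih fun l' t' ht' => h l' t' ⟨ht.1.trans ht'.1, ht'.2⟩]

lemma iterInt_smul {d : Bool → ℝ → ℝ≥0∞} (c : ℝ≥0∞) (hc : c ≠ ∞) (e : ℝ) (w : List Bool) (s : ℝ) :
    iterInt (fun l t => c * d l t) e w s = c ^ w.length * iterInt d e w s := by
  induction w generalizing s with
  | nil => simp [iterInt]
  | cons l w ih =>
    rw [iterInt, iterInt, ← lintegral_const_mul' _ _ (by finiteness)]
    refine lintegral_congr fun t => ?_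
    rw [ih, List.length_cons]
    ring

lemma lintegral_pow_sub (s e : ℝ) (hse : s ≤ e) (n : ℕ) :
    ∫⁻ t in Ioc s e, ((e - t).toNNReal ^ n : ℝ≥0) =
      (((e - s).toNNReal ^ (n + 1) / (n + 1) : ℝ≥0) : ℝ≥0∞) := by
  have h1 : ∫⁻ t in Ioc s e, (((e - t).toNNReal ^ n : ℝ≥0) : ℝ≥0∞) =
      ∫⁻ t in Ioc s e, ENNReal.ofReal ((e - t) ^ n) := by
    refine setLIntegral_congr_fun measurableSet_Ioc fun t ht => ?_
    have : 0 ≤ e - t := by linarith [ht.2]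
    rw [ENNReal.ofReal, Real.toNNReal_pow this]
  have hint : IntervalIntegrable (fun t => (e - t) ^ n) volume s e :=
    (by fun_prop : Continuous fun t : ℝ => (e - t) ^ n).intervalIntegrable _ _
  rw [h1, ← ofReal_integral_eq_lintegral_ofReal ((intervalIntegrable_iff_integrableOn_Ioc_of_le
    hse).1 hint) ((ae_restrict_iff' measurableSet_Ioc).2 (ae_of_all _ fun t ht => by
      have : 0 ≤ e - t := by linarith [ht.2]
      positivity)), ← intervalIntegral.integral_of_le hse,
    intervalIntegral.integral_comp_sub_left (fun x => x ^ n) e, integral_pow]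
  have : 0 ≤ e - s := by linarith
  rw [ENNReal.ofReal]
  congr 1
  ext
  rw [Real.coe_toNNReal _ (by simp; positivity)]
  push_cast
  rw [Real.coe_toNNReal _ this]
  simp

lemma iterInt_const (c : Bool → ℝ≥0) (w : List Bool) {s e : ℝ} (hse : s ≤ e) :
    iterInt (fun l _ => c l) e w s = flat (fun l => (e - s).toNNReal * c l) w := by
  induction w generalizing s with
  | nil => simp [iterInt, flat]
  | cons l w ih =>
    rw [iterInt, setLIntegral_congr_fun (g := fun t => ((c l * flat c w : ℝ≥0) : ℝ≥0∞) *
      ((e - t).toNNReal ^ w.length : ℝ≥0)) measurableSet_Ioc fun t ht => by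
        simp only []
        rw [ih ht.2, flat_smul]
        push_cast
        ring, lintegral_const_mul' _ _ ENNReal.coe_ne_top, lintegral_pow_sub s e hse,
      flat_smul, ← ENNReal.coe_mul]
    congr 1
    simp only [flat, List.map_cons, List.prod_cons, List.length_cons, Nat.factorial_succ]
    have := Nat.factorial_ne_zero w.length
    push_cast
    field_simp

/-- The Beta integral in normalised form; integration by parts trades `c` for `a`. The value depends
only on `a + c`, which is why the start of the mini-bucket block becomes uniform. -/
lemma lintegral_pow_mul_pow_sub {D : ℝ} (hD : 0 ≤ D) (a c : ℕ) :
    ∫⁻ t in Ioc 0 D, ((t.toNNReal ^ a / a.factorial * ((D - t).toNNReal ^ c / c.factorial) :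
      ℝ≥0) : ℝ≥0∞) = ((D.toNNReal ^ (a + c + 1) / (a + c + 1).factorial : ℝ≥0) : ℝ≥0∞) := by
  have hparts : ∀ a c : ℕ, ∫ t in (0:ℝ)..D, t ^ a / a.factorial * ((D - t) ^ c / c.factorial) =
      D ^ (a + c + 1) / (a + c + 1).factorial := by
    intro a c
    induction c generalizing a with
    | zero =>
      simp only [pow_zero, Nat.factorial_zero, Nat.cast_one, div_one, mul_one, add_zero]
      rw [intervalIntegral.integral_div, integral_pow, Nat.factorial_succ]
      have := Nat.factorial_ne_zero a
      push_cast
      field_simp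
      simp
    | succ c ih =>
      have hu : ∀ t : ℝ, HasDerivAt (fun t : ℝ => (D - t) ^ (c + 1) / (c + 1).factorial)
          (-((D - t) ^ c / c.factorial)) t := fun t => by
        have := (((hasDerivAt_id t).const_sub D).pow (c + 1)).div_const
          ((c + 1).factorial : ℝ)
        refine this.congr_deriv ?_
        rw [Nat.factorial_succ]
        have := Nat.factorial_ne_zero c
        push_cast
        field_simp
        simp
      have hv : ∀ t : ℝ, HasDerivAt (fun t : ℝ => t ^ (a + 1) / (a + 1).factorial)
          (t ^ a / a.factorial) t := fun t => by
        have := ((hasDerivAt_id t).pow (a + 1)).div_const ((a + 1).factorial : ℝ)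
        refine this.congr_deriv ?_
        rw [Nat.factorial_succ]
        have := Nat.factorial_ne_zero a
        push_cast
        field_simp
        simp
      have := intervalIntegral.integral_mul_deriv_eq_deriv_mul (a := 0) (b := D)
        (fun t _ => hu t) (fun t _ => hv t)
        ((by fun_prop : Continuous fun t : ℝ => -((D - t) ^ c / c.factorial)).intervalIntegrable
          _ _)
        ((by fun_prop : Continuous fun t : ℝ => t ^ a / a.factorial).intervalIntegrable _ _)
      simp only [sub_self, ne_eq, Nat.add_eq_zero_iff, one_ne_zero, and_false, not_false_eq_true,
        zero_pow, zero_div, zero_mul, mul_zero, neg_mul, intervalIntegral.integral_neg, zero_sub,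
        neg_neg] at this
      calc _ = ∫ t in (0:ℝ)..D, (D - t) ^ (c + 1) / (c + 1).factorial * (t ^ a / a.factorial) :=
            intervalIntegral.integral_congr fun t _ => mul_comm _ _
        _ = ∫ t in (0:ℝ)..D, t ^ (a + 1) / (a + 1).factorial * ((D - t) ^ c / c.factorial) := by
            rw [this]
            exact intervalIntegral.integral_congr fun t _ => mul_comm _ _
        _ = _ := by
            rw [ih (a + 1), show a + 1 + c + 1 = a + (c + 1) + 1 by ring]
  have h1 : ∀ t ∈ Ioc 0 D, ((t.toNNReal ^ a / a.factorial * ((D - t).toNNReal ^ c / c.factorial) :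
      ℝ≥0) : ℝ≥0∞) = ENNReal.ofReal (t ^ a / a.factorial * ((D - t) ^ c / c.factorial)) := by
    intro t ht
    have h1 : 0 ≤ D - t := by linarith [ht.2]
    have h2 := ht.1.le
    rw [ENNReal.ofReal]
    congr 1
    ext
    rw [Real.coe_toNNReal _ (by positivity)]
    push_cast
    rw [Real.coe_toNNReal _ h1, Real.coe_toNNReal _ h2]
  have hint : IntervalIntegrable (fun t => t ^ a / a.factorial * ((D - t) ^ c / c.factorial))
      volume 0 D :=
    (by fun_prop : Continuous fun t : ℝ => t ^ a / a.factorial *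
      ((D - t) ^ c / c.factorial)).intervalIntegrable _ _
  rw [setLIntegral_congr_fun measurableSet_Ioc h1,
    ← ofReal_integral_eq_lintegral_ofReal ((intervalIntegrable_iff_integrableOn_Ioc_of_le
    hD).1 hint) ((ae_restrict_iff' measurableSet_Ioc).2 (ae_of_all _ fun t ht => by
      have h1 : 0 ≤ D - t := by linarith [ht.2]
      have h2 := ht.1.le
      positivity)), ← intervalIntegral.integral_of_le hD, hparts]
  rw [ENNReal.ofReal]
  congr 1
  ext
  rw [Real.coe_toNNReal _ (by positivity)]
  push_cast
  rw [Real.coe_toNNReal _ hD]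

/-! ### The word of one macro-bucket -/

/-- The weight of the word of a macro-bucket made of an interval of length `y`, a mini-bucket of
length `4 * η` and an interval of length `r`. -/
noncomputable def macroAt (m y η r : ℝ≥0) : List Bool → ℝ≥0 :=
  conv (flat fun _ => m * y)
    (conv (fun v => (4 * m * η) ^ v.length * miniWeight v) (flat fun _ => m * r))

lemma coe_conv (A B : List Bool → ℝ≥0) (w : List Bool) :
    ((conv A B w : ℝ≥0) : ℝ≥0∞) = conv (fun u => (A u : ℝ≥0∞)) (fun u => (B u : ℝ≥0∞)) w :=
  map_conv ENNReal.ofNNRealHom A B w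

lemma iterInt_eq_flat {d : Bool → ℝ → ℝ≥0∞} {c : Bool → ℝ≥0} {s e : ℝ} (len : ℝ≥0)
    (hse : e = s + len) (h : ∀ l, ∀ t ∈ Ioo s e, d l t = c l) (w : List Bool) :
    iterInt d e w s = flat (fun l => len * c l) w := by
  rw [iterInt_congr (d' := fun l _ => c l) h, iterInt_const c w (by rw [hse]; simp)]
  simp [hse]

lemma iterInt_macro {d : Bool → ℝ → ℝ≥0∞} (hd : ∀ l, Measurable (d l)) (s : ℝ) (m y η r : ℝ≥0)
    (h1 : ∀ l, ∀ t ∈ Ioo s (s + y), d l t = m)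
    (h2 : ∀ l, ∀ t ∈ Ioo (s + y) (s + y + η), d l t = (if l then 2 * m else 0 : ℝ≥0))
    (h3 : ∀ l, ∀ t ∈ Ioo (s + y + η) (s + y + 3 * η), d l t = (if l then 0 else 2 * m : ℝ≥0))
    (h4 : ∀ l, ∀ t ∈ Ioo (s + y + 3 * η) (s + y + 4 * η), d l t = (if l then 2 * m else 0 : ℝ≥0))
    (h5 : ∀ l, ∀ t ∈ Ioo (s + y + 4 * η) (s + y + 4 * η + r), d l t = m) (w : List Bool) :
    iterInt d (s + y + 4 * η + r) w s = macroAt m y η r w := by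
  have hη := η.coe_nonneg
  have hy := y.coe_nonneg
  have hr := r.coe_nonneg
  have ho : (fun l => η * (if l then 2 * m else 0 : ℝ≥0)) =
      fun l => 4 * m * η * outerMass l := by
    funext l
    cases l
    · simp [outerMass]
    · simp only [if_true, outerMass]
      rw [show (4 : ℝ≥0) = 2 * 2 by norm_num]
      field_simp
  have hm : (fun l => 2 * η * (if l then 0 else 2 * m : ℝ≥0)) =
      fun l => 4 * m * η * middleMass l := by
    funext l
    cases l
    · simp [middleMass]; ring
    · simp [middleMass]
  have hmini : ∀ u, iterInt d (s + y + 4 * η) u (s + y) =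
      (((4 * m * η) ^ u.length * miniWeight u : ℝ≥0) : ℝ≥0∞) := by
    intro u
    rw [← miniWeight_smul, coe_conv,
      iterInt_split hd (by linarith : s + y + η ≤ s + y + 4 * η) u (by linarith)]
    congr 1
    · funext v
      rw [iterInt_eq_flat η rfl h2, ho]
    · funext v
      rw [coe_conv, iterInt_split hd (by linarith : s + y + 3 * η ≤ s + y + 4 * η) v (by linarith)]
      congr 1
      · funext v
        rw [iterInt_eq_flat (2 * η) (by push_cast; ring) h3, hm]
      · funext v
        rw [iterInt_eq_flat η (by ring) h4, ho]
  rw [macroAt, coe_conv, iterInt_split hd (by linarith : s + y ≤ s + y + 4 * η + r) w (by linarith)]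
  congr 1
  · funext v
    rw [iterInt_eq_flat y rfl h1]
    simp_rw [mul_comm]
  · funext v
    rw [coe_conv, iterInt_split hd (by linarith : s + y + 4 * η ≤ s + y + 4 * η + r) v
      (by linarith)]
    congr 1
    · funext v
      exact hmini v
    · funext v
      rw [iterInt_eq_flat r rfl h5]
      simp_rw [mul_comm]

/-- Isolates the dependence on the position, through `y` and `r`, in a single factor ready for the
Beta integral. -/
lemma macroAt_eq_sum (m y η r : ℝ≥0) (w : List Bool) :
    macroAt m y η r w = ∑ p ∈ blocks w.length,
      m ^ (w.length - p.1) * (4 * m * η) ^ p.1 * miniWeight ((w.drop p.2).take p.1) *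
        (y ^ p.2 / p.2.factorial *
          (r ^ (w.length - p.1 - p.2) / (w.length - p.1 - p.2).factorial)) := by
  rw [macroAt, conv_eq_sum, sum_blocks w.length fun j i =>
      m ^ (w.length - j) * (4 * m * η) ^ j * miniWeight ((w.drop i).take j) *
        (y ^ i / i.factorial * (r ^ (w.length - j - i) / (w.length - j - i).factorial)),
    Finset.sum_comm' (t' := Finset.range (w.length + 1))
      (s' := fun i => Finset.range (w.length - i + 1)) fun j i => by
        simp only [Finset.mem_range]; omega]
  refine Finset.sum_congr rfl fun i hi => ?_
  have hi' := Nat.lt_succ_iff.1 (Finset.mem_range.1 hi)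
  rw [conv_eq_sum, List.length_drop, Finset.mul_sum]
  refine Finset.sum_congr rfl fun j hj => ?_
  have hj' := Nat.lt_succ_iff.1 (Finset.mem_range.1 hj)
  obtain ⟨a, ha⟩ := Nat.exists_eq_add_of_le hj'
  have e1 : w.length = i + j + a := by omega
  rw [flat_const, flat_const]
  simp only [List.length_take, List.length_drop]
  rw [e1, min_eq_left (by omega), min_eq_left (by omega), show i + j + a - i - j = a by omega,
    show i + j + a - j = i + a by omega, show i + a - i = a by omega, mul_pow m, mul_pow m, pow_add]
  ring

lemma lintegral_cond_Icc {D : ℝ} (f : ℝ → ℝ≥0∞) :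
    ∫⁻ y, f y ∂((volume : Measure ℝ)[|Icc 0 D]) = (ENNReal.ofReal D)⁻¹ * ∫⁻ y in Ioc 0 D, f y := by
  rw [ProbabilityTheory.cond, lintegral_smul_measure, Real.volume_Icc, sub_zero, smul_eq_mul,
    setLIntegral_congr Ioc_ae_eq_Icc.symm]

lemma lintegral_macroAt {D : ℝ≥0} (hD : 0 < D) (m η : ℝ≥0) {t ε δ : ℝ≥0} (hδ : m * D = t * δ)
    (hε : 4 * m * η = t * ε) (w : List Bool) :
    ∫⁻ y, (macroAt m y.toNNReal η ((D : ℝ) - y).toNNReal w : ℝ≥0∞)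
      ∂((volume : Measure ℝ)[|Icc 0 (D : ℝ)]) = macroWeight t ε δ w := by
  have hD' : (D : ℝ≥0∞) ≠ 0 := by simpa using hD.ne'
  rw [lintegral_cond_Icc]
  simp_rw [macroAt_eq_sum, ENNReal.ofNNReal_finsetSum, ENNReal.coe_mul (_ * _ * _)]
  rw [lintegral_finsetSum' _ fun i _ => by fun_prop, Finset.mul_sum, macroWeight,
    ENNReal.ofNNReal_finsetSum]
  refine Finset.sum_congr rfl fun p hp => ?_
  have hp' := mem_blocks.1 hp
  rw [lintegral_const_mul' _ _ ENNReal.coe_ne_top, lintegral_pow_mul_pow_sub D.coe_nonneg,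
    ENNReal.ofReal_coe_nnreal, Real.toNNReal_coe, ← ENNReal.coe_inv hD.ne', ← ENNReal.coe_mul,
    ← ENNReal.coe_mul, ← hδ, ← hε]
  congr 1
  -- One power of `D` from the Beta integral cancels the normalisation `1 / D` of the uniform law.
  rw [show p.2 + (w.length - p.1 - p.2) = w.length - p.1 by omega, mul_pow m D, pow_succ D]
  field_simp

/-! ### All macro-buckets together -/

/-- Independence of the positions: by Fubini the average passes inside the convolution, one bucket
at a time. -/
lemma lintegral_convFold {U : Measure ℝ} [SigmaFinite U] {A : ℝ → List Bool → ℝ≥0∞}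
    (hA : ∀ u, Measurable fun y => A y u) (k : ℕ) (w : List Bool) :
    ∫⁻ x, convFold (List.ofFn fun i : Fin k => A (x i)) w ∂(Measure.pi fun _ : Fin k => U) =
      convFold (List.replicate k fun u => ∫⁻ y, A y u ∂U) w := by
  have hmeas : ∀ k u, Measurable fun x : Fin k → ℝ =>
      convFold (List.ofFn fun i => A (x i)) u := by
    intro k
    induction k with
    | zero => simp [convFold]
    | succ k ih =>
      intro u
      simp only [convFold, List.ofFn_succ, List.foldr_cons] at ih ⊢
      refine measurable_conv (fun v => (hA v).comp (measurable_pi_apply 0)) (fun v => ?_) u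
      exact (ih v).comp (by fun_prop : Measurable fun (x : Fin (k + 1) → ℝ) (i : Fin k) => x i.succ)
  induction k generalizing w with
  | zero => simp [convFold]
  | succ k ih =>
    have hmp := (measurePreserving_piFinSuccAbove (fun _ : Fin (k + 1) => U) 0).symm
    rw [← hmp.lintegral_comp_emb (MeasurableEquiv.measurableEmbedding _)]
    simp only [List.ofFn_succ, List.replicate_succ, convFold, List.foldr_cons] at ih hmeas ⊢
    have hF : Measurable fun a : ℝ × (Fin k → ℝ) =>
        conv (A a.1) (List.foldr conv convOne (List.ofFn fun i => A (a.2 i))) w :=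
      measurable_conv (fun u => (hA u).comp measurable_fst)
        (fun u => (hmeas k u).comp measurable_snd) w
    have hcongr : ∀ a : ℝ × (Fin k → ℝ),
        conv (A ((MeasurableEquiv.piFinSuccAbove (fun _ : Fin (k + 1) => ℝ) 0).symm a 0))
          (List.foldr conv convOne (List.ofFn fun i : Fin k =>
            A ((MeasurableEquiv.piFinSuccAbove (fun _ : Fin (k + 1) => ℝ) 0).symm a i.succ))) w =
        conv (A a.1) (List.foldr conv convOne (List.ofFn fun i => A (a.2 i))) w := by
      intro a
      simp [MeasurableEquiv.piFinSuccAbove, Fin.insertNthEquiv]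
    rw [lintegral_congr hcongr]
    refine (lintegral_prod _ hF.aemeasurable).trans ?_
    simp only [conv_eq_sum]
    rw [lintegral_congr fun a => lintegral_finsetSum _ fun i _ => (hmeas k _).const_mul _,
      lintegral_finsetSum _ fun i _ => by
        simp_rw [lintegral_const_mul _ (hmeas k _)]
        exact (hA _).mul_const _]
    refine Finset.sum_congr rfl fun i _ => ?_
    simp_rw [lintegral_const_mul _ (hmeas k _)]
    rw [lintegral_mul_const _ (hA _)]
    exact congrArg _ (ih _)

/-- The densities of `p` and `q`, times `m`, as a function of the letter. -/
noncomputable def letterDensity (k : ℕ) (ε : ℝ) (m : ℝ≥0) (X : Fin 2) (x : Fin k → ℝ) (l : Bool)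
    (t : ℝ) : ℝ≥0∞ :=
  m * if l then qDensity k ε X x t else pDensity k ε X x t

lemma measurable_letterDensity (k : ℕ) (ε : ℝ) (m : ℝ≥0) (X : Fin 2) (x : Fin k → ℝ) (l : Bool) :
    Measurable (letterDensity k ε m X x l) := by
  have hq := (measurable_qDensity k ε).comp (measurable_prodMk_left (x := (X, x)))
  have hp := (measurable_pDensity k ε).comp (measurable_prodMk_left (x := (X, x)))
  cases l
  · exact hp.const_mul (m : ℝ≥0∞)
  · exact hq.const_mul (m : ℝ≥0∞)

lemma letterDensity_one (k : ℕ) (ε : ℝ) (m : ℝ≥0) (x : Fin k → ℝ) (l : Bool) (t : ℝ) :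
    letterDensity k ε m 1 x l t = m := by
  simp [letterDensity, pDensity, qDensity]

/-- Since `0 ≤ x j ≤ (1 - ε) / k`, a mini-bucket never leaves its own macro-bucket. -/
lemma bucket_eq {k : ℕ} {ε : ℝ} {x : Fin k → ℝ}
    (hx : ∀ i, x i ∈ Icc 0 ((1 - ε) / k)) {i j : Fin k} {t : ℝ}
    (ht : t ∈ Ioo ((i : ℝ) / k) (((i : ℝ) + 1) / k)) (h1 : (j : ℝ) / k + x j ≤ t)
    (h2 : t < (j : ℝ) / k + x j + ε / k) : j = i := by
  have hk : (0 : ℝ) < k := by exact_mod_cast i.pos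
  have h3 : (j : ℝ) / k ≤ t := by linarith [(hx j).1]
  have h4 : t < ((j : ℝ) + 1) / k := by
    refine h2.trans_le ?_
    have := (hx j).2
    calc (j : ℝ) / k + x j + ε / k ≤ j / k + (1 - ε) / k + ε / k := by gcongr
      _ = _ := by ring
  have h5 : (j : ℝ) < i + 1 := (div_lt_div_iff_of_pos_right hk).1 (h3.trans_lt ht.2)
  have h6 : (i : ℝ) < j + 1 := (div_lt_div_iff_of_pos_right hk).1 (ht.1.trans h4)
  have h7 : (j : ℕ) < i + 1 := by exact_mod_cast h5
  have h8 : (i : ℕ) < j + 1 := by exact_mod_cast h6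
  exact Fin.ext (by omega)

lemma inMini_iff {k : ℕ} {ε : ℝ} {x : Fin k → ℝ}
    (hx : ∀ i, x i ∈ Icc 0 ((1 - ε) / k)) {i : Fin k} {t : ℝ}
    (ht : t ∈ Ioo ((i : ℝ) / k) (((i : ℝ) + 1) / k)) :
    InMini k ε x t ↔ (i : ℝ) / k + x i ≤ t ∧ t < (i : ℝ) / k + x i + ε / k := by
  refine ⟨fun ⟨j, h1, h2⟩ => ?_, fun h => ⟨i, h⟩⟩
  obtain rfl := bucket_eq hx ht h1 h2
  exact ⟨h1, h2⟩

lemma inMiddle_iff {k : ℕ} {ε : ℝ} (hε : 0 ≤ ε) {x : Fin k → ℝ}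
    (hx : ∀ i, x i ∈ Icc 0 ((1 - ε) / k)) {i : Fin k} {t : ℝ}
    (ht : t ∈ Ioo ((i : ℝ) / k) (((i : ℝ) + 1) / k)) :
    InMiddle k ε x t ↔ (i : ℝ) / k + x i + ε / (4 * k) ≤ t ∧
      t < (i : ℝ) / k + x i + 3 * ε / (4 * k) := by
  refine ⟨fun ⟨j, h1, h2⟩ => ?_, fun h => ⟨i, h⟩⟩
  have hk : (0 : ℝ) < k := by exact_mod_cast i.pos
  have e2 : 3 * ε / (4 * k) ≤ ε / k := by
    rw [div_le_div_iff₀ (by positivity) hk]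
    calc 3 * ε * k ≤ 4 * ε * k := by gcongr; norm_num
      _ = _ := by ring
  have e1 : 0 ≤ ε / (4 * k) := by positivity
  obtain rfl := bucket_eq hx ht (by linarith) (by linarith)
  exact ⟨h1, h2⟩

lemma iterInt_bucket {k : ℕ} {ε η D : ℝ≥0} (hη : (ε : ℝ) / k = 4 * η)
    (hD : (1 - (ε : ℝ)) / k = D) (m : ℝ≥0) {x : Fin k → ℝ}
    (hx : ∀ i, x i ∈ Icc 0 (D : ℝ)) (i : Fin k) (w : List Bool) :
    iterInt (letterDensity k ε m 0 x) (((i + 1 : ℕ) : ℝ) / k) w ((i : ℝ) / k) =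
      macroAt m (x i).toNNReal η ((D : ℝ) - x i).toNNReal w := by
  have hk : (0 : ℝ) < k := by exact_mod_cast i.pos
  have hx' : ∀ i, x i ∈ Icc 0 ((1 - (ε : ℝ)) / k) := by rwa [hD]
  have h0 := (hx i).1
  have h1 : 0 ≤ (D : ℝ) - x i := by linarith [(hx i).2]
  have hη0 := η.coe_nonneg
  have hlast : ((i : ℝ) + 1) / k = i / k + x i + 4 * η + (D - x i) := by
    rw [← hη, ← hD]; ring
  have hη1 : (ε : ℝ) / (4 * k) = η := by
    rw [mul_comm, ← div_div, hη]; ring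
  have hη3 : 3 * (ε : ℝ) / (4 * k) = 3 * η := by
    rw [mul_div_assoc, hη1]
  have hend : ((i + 1 : ℕ) : ℝ) / k = i / k + ((x i).toNNReal : ℝ) + 4 * η +
      (((D : ℝ) - x i).toNNReal : ℝ) := by
    rw [Real.coe_toNNReal _ h0, Real.coe_toNNReal _ h1, ← hlast]
    push_cast
    rfl
  have hmini : ∀ t ∈ Ioo ((i : ℝ) / k) (((i : ℝ) + 1) / k),
      (InMini k ε x t ↔ (i : ℝ) / k + x i ≤ t ∧ t < (i : ℝ) / k + x i + 4 * η) := fun t ht => by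
    rw [inMini_iff hx' ht, hη]
  have hmid : ∀ t ∈ Ioo ((i : ℝ) / k) (((i : ℝ) + 1) / k),
      (InMiddle k ε x t ↔ (i : ℝ) / k + x i + η ≤ t ∧ t < (i : ℝ) / k + x i + 3 * η) :=
    fun t ht => by rw [inMiddle_iff ε.coe_nonneg hx' ht, hη1, hη3]
  have hout : ∀ l, ∀ t ∈ Ioo ((i : ℝ) / k) (((i : ℝ) + 1) / k), ¬ InMini k ε x t →
      letterDensity k ε m 0 x l t = m := fun l t ht h => by
    simp [letterDensity, pDensity, qDensity, h]
  have houter : ∀ l, ∀ t ∈ Ioo ((i : ℝ) / k) (((i : ℝ) + 1) / k), InMini k ε x t →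
      ¬ InMiddle k ε x t → letterDensity k ε m 0 x l t = (if l then 2 * m else 0 : ℝ≥0) :=
    fun l t ht h h' => by
      cases l <;> simp [letterDensity, pDensity, qDensity, h, h', mul_comm]
  have hinner : ∀ l, ∀ t ∈ Ioo ((i : ℝ) / k) (((i : ℝ) + 1) / k), InMini k ε x t →
      InMiddle k ε x t → letterDensity k ε m 0 x l t = (if l then 0 else 2 * m : ℝ≥0) :=
    fun l t ht h h' => by
      cases l <;> simp [letterDensity, pDensity, qDensity, h, h', mul_comm]
  rw [hend]
  rw [hlast] at hmini hmid hout houter hinner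
  apply iterInt_macro (measurable_letterDensity k ε m 0 x) <;>
    simp only [Real.coe_toNNReal _ h0, Real.coe_toNNReal _ h1] <;> intro l t ht
  · have ht' : t ∈ Ioo ((i : ℝ) / k) (i / k + x i + 4 * η + (D - x i)) :=
      ⟨by linarith [ht.1], by linarith [ht.2]⟩
    exact hout l t ht' (by rw [hmini t ht']; rintro ⟨h, -⟩; linarith [ht.2])
  · have ht' : t ∈ Ioo ((i : ℝ) / k) (i / k + x i + 4 * η + (D - x i)) :=
      ⟨by linarith [ht.1], by linarith [ht.2]⟩
    exact houter l t ht' (by rw [hmini t ht']; constructor <;> linarith [ht.1, ht.2])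
      (by rw [hmid t ht']; rintro ⟨h, -⟩; linarith [ht.2])
  · have ht' : t ∈ Ioo ((i : ℝ) / k) (i / k + x i + 4 * η + (D - x i)) :=
      ⟨by linarith [ht.1], by linarith [ht.2]⟩
    exact hinner l t ht' (by rw [hmini t ht']; constructor <;> linarith [ht.1, ht.2])
      (by rw [hmid t ht']; constructor <;> linarith [ht.1, ht.2])
  · have ht' : t ∈ Ioo ((i : ℝ) / k) (i / k + x i + 4 * η + (D - x i)) :=
      ⟨by linarith [ht.1], by linarith [ht.2]⟩
    exact houter l t ht' (by rw [hmini t ht']; constructor <;> linarith [ht.1, ht.2])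
      (by rw [hmid t ht']; rintro ⟨-, h⟩; linarith [ht.1])
  · have ht' : t ∈ Ioo ((i : ℝ) / k) (i / k + x i + 4 * η + (D - x i)) :=
      ⟨by linarith [ht.1], by linarith [ht.2]⟩
    exact hout l t ht' (by rw [hmini t ht']; rintro ⟨-, h⟩; linarith [ht.1])

lemma iterInt_all_buckets {k : ℕ} (hk : 0 < k) {ε η D : ℝ≥0} (hη : (ε : ℝ) / k = 4 * η)
    (hD : (1 - (ε : ℝ)) / k = D) (m : ℝ≥0) {x : Fin k → ℝ}
    (hx : ∀ i, x i ∈ Icc 0 (D : ℝ)) (w : List Bool) :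
    iterInt (letterDensity k ε m 0 x) 1 w 0 =
      convFold (List.ofFn fun i : Fin k => fun u =>
        (macroAt m (x i).toNNReal η ((D : ℝ) - x i).toNNReal u : ℝ≥0∞)) w := by
  have hk' : (0 : ℝ) < k := by exact_mod_cast hk
  have h := iterInt_grid (measurable_letterDensity k ε m 0 x) (fun n : ℕ => (n : ℝ) / k)
    (fun a b hab => by dsimp only; gcongr) k w
  simp only [Nat.cast_zero, zero_div, div_self hk'.ne'] at h
  rw [h]
  congr 2
  funext i u
  exact iterInt_bucket hη hD m hx i u

/-- The law of the positions of the mini-buckets. -/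
noncomputable abbrev positionLaw (k : ℕ) (ε : ℝ) : Measure (Fin k → ℝ) :=
  Measure.pi fun _ : Fin k => (volume : Measure ℝ)[|Icc 0 ((1 - ε) / k)]

lemma isProbabilityMeasure_cond_Icc {D : ℝ} (hD : 0 < D) :
    IsProbabilityMeasure ((volume : Measure ℝ)[|Icc 0 D]) :=
  cond_isProbabilityMeasure_of_finite (by simpa using hD) (by simp)

lemma lintegral_iterInt_zero {k : ℕ} (hk : 0 < k) {ε δ : ℝ≥0} (hεδ : ε + δ = 1) (hδ : 0 < δ)
    (m : ℝ≥0) (w : List Bool) :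
    ∫⁻ x, iterInt (letterDensity k ε m 0 x) 1 w 0 ∂(positionLaw k ε) =
      convFold (List.replicate k (macroWeight (m / k) ε δ)) w := by
  have hk' : (0 : ℝ≥0) < k := by exact_mod_cast hk
  have hD : (1 - (ε : ℝ)) / k = (δ / k : ℝ≥0) := by
    have : (1 : ℝ) = ε + δ := by exact_mod_cast hεδ.symm
    push_cast
    rw [this]
    ring
  have hη : (ε : ℝ) / k = 4 * (ε / (4 * k) : ℝ≥0) := by
    push_cast
    field_simp
  have hD0 : 0 < δ / k := by positivity
  have hprob := isProbabilityMeasure_cond_Icc (NNReal.coe_pos.2 hD0)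
  -- The bucket formula requires positions in range, which holds only almost surely under the
  -- position law.
  have hae : ∀ᵐ x ∂(positionLaw k ε), ∀ i, x i ∈ Icc 0 ((δ / k : ℝ≥0) : ℝ) := by
    rw [ae_all_iff]
    intro i
    rw [positionLaw, hD]
    have : ∀ᵐ y ∂((volume : Measure ℝ)[|Icc 0 ((δ / k : ℝ≥0) : ℝ)]),
        y ∈ Icc 0 ((δ / k : ℝ≥0) : ℝ) := ae_cond_mem measurableSet_Icc
    exact (Measure.quasiMeasurePreserving_eval _ i).ae this
  rw [lintegral_congr_ae (hae.mono fun x hx => iterInt_all_buckets hk hη hD m hx w), positionLaw,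
    hD, lintegral_convFold (A := fun y u => (macroAt m y.toNNReal (ε / (4 * k))
      (((δ / k : ℝ≥0) : ℝ) - y).toNNReal u : ℝ≥0∞)) fun u => by
        simp only [macroAt_eq_sum]; fun_prop]
  refine Eq.trans ?_ (map_convFold ENNReal.ofNNRealHom _ w).symm
  rw [List.map_replicate]
  congr 2
  funext u
  exact lintegral_macroAt hD0 m _ (by field_simp) (by field_simp) u

/-! ### The ordering of a sample and its smallest draw -/

/-- All draws of a sample. -/
def draws (a b : ℕ) : List (Fin a ⊕ Fin b) :=
  (List.finRange a).map Sum.inl ++ (List.finRange b).map Sum.inr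

lemma mem_draws {a b : ℕ} (s : Fin a ⊕ Fin b) : s ∈ draws a b := by
  cases s <;> simp [draws]

lemma nodup_draws (a b : ℕ) : (draws a b).Nodup := by
  refine List.Nodup.append ((List.nodup_finRange a).map Sum.inl_injective)
    ((List.nodup_finRange b).map Sum.inr_injective) ?_
  intro s h1 h2
  simp only [List.mem_map] at h1 h2
  obtain ⟨i, -, rfl⟩ := h1
  obtain ⟨j, -, h⟩ := h2
  cases h

open Classical in
lemma ordering_eq (a b : ℕ) (z : (Fin a → ℝ) × (Fin b → ℝ)) :
    ordering a b z = ((draws a b).insertionSort fun s t =>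
      Sum.elim z.1 z.2 s ≤ Sum.elim z.1 z.2 t).map Sum.isRight := by
  rw [ordering, wordOf, draws]

lemma ordering_perm (a b : ℕ) (z : (Fin a → ℝ) × (Fin b → ℝ)) :
    (ordering a b z).Perm ((draws a b).map Sum.isRight) := by
  classical
  rw [ordering_eq]
  exact (List.perm_insertionSort _ _).map _

lemma map_isRight_draws (a b : ℕ) :
    (draws a b).map Sum.isRight = List.replicate a false ++ List.replicate b true := by
  rw [draws, List.map_append, List.map_map, List.map_map]
  congr 1
  · rw [List.eq_replicate_iff]; simp
  · rw [List.eq_replicate_iff]; simp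

lemma count_false_ordering (a b : ℕ) (z : (Fin a → ℝ) × (Fin b → ℝ)) :
    (ordering a b z).count false = a := by
  rw [(ordering_perm a b z).count_eq, map_isRight_draws]
  simp [List.count_replicate]

lemma count_true_ordering (a b : ℕ) (z : (Fin a → ℝ) × (Fin b → ℝ)) :
    (ordering a b z).count true = b := by
  rw [(ordering_perm a b z).count_eq, map_isRight_draws]
  simp [List.count_replicate]

/-- Injectivity of `v` makes the sorted arrangement unique, so a minimum followed by the sorted
remainder must be it. The map `f` embeds the remaining draws. -/
lemma insertionSort_eq_cons {α β : Type*} {v : α → ℝ} (hv : Function.Injective v)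
    [DecidableRel fun s t => v s ≤ v t] {s₀ : α} {f : β → α}
    [DecidableRel fun s t => v (f s) ≤ v (f t)] (hmin : ∀ s, v s₀ ≤ v s)
    (hf : Function.Injective f) (hs₀ : ∀ s, f s ≠ s₀) (hrange : ∀ t, t ≠ s₀ → ∃ s, f s = t)
    {L : List α} {L' : List β} (hL : ∀ s, s ∈ L) (hLn : L.Nodup) (hL' : ∀ s, s ∈ L')
    (hLn' : L'.Nodup) :
    L.insertionSort (fun s t => v s ≤ v t) =
      s₀ :: (L'.insertionSort fun s t => v (f s) ≤ v (f t)).map f := by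
  have htot : Std.Total fun s t => v s ≤ v t := ⟨fun s t => le_total _ _⟩
  have htrans : IsTrans α fun s t => v s ≤ v t := ⟨fun _ _ _ => le_trans⟩
  have hanti : Std.Antisymm fun s t => v s ≤ v t := ⟨fun _ _ h h' => hv (le_antisymm h h')⟩
  have htot' : Std.Total fun s t => v (f s) ≤ v (f t) := ⟨fun s t => le_total _ _⟩
  have htrans' : IsTrans β fun s t => v (f s) ≤ v (f t) := ⟨fun _ _ _ => le_trans⟩
  refine List.Perm.eq_of_pairwise' (r := fun s t => v s ≤ v t) (List.pairwise_insertionSort _ _)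
    ?_ ?_
  · rw [List.pairwise_cons, List.pairwise_map]
    exact ⟨fun s _ => hmin s, List.pairwise_insertionSort (fun s t => v (f s) ≤ v (f t)) L'⟩
  · refine (List.perm_insertionSort _ _).trans (((List.perm_ext_iff_of_nodup hLn ?_).2 ?_).trans
      (((List.perm_insertionSort _ L').map f).cons s₀).symm)
    · refine List.nodup_cons.2 ⟨?_, hLn'.map hf⟩
      simp [hs₀]
    · intro t
      simp only [hL, List.mem_cons, List.mem_map, hL', true_and, true_iff]
      by_cases ht : t = s₀
      · exact Or.inl ht
      · exact Or.inr (hrange t ht)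

lemma ordering_of_min_inl {a b : ℕ} {z : (Fin (a + 1) → ℝ) × (Fin b → ℝ)}
    (hz : Function.Injective (Sum.elim z.1 z.2)) {i : Fin (a + 1)}
    (hmin : ∀ s, z.1 i ≤ Sum.elim z.1 z.2 s) :
    ordering (a + 1) b z = false :: ordering a b (fun j => z.1 (i.succAbove j), z.2) := by
  classical
  have he : ∀ s, Sum.elim z.1 z.2 (Sum.map i.succAbove id s) =
      Sum.elim (fun j => z.1 (i.succAbove j)) z.2 s := by
    rintro (s | s) <;> rfl
  rw [ordering_eq, ordering_eq, insertionSort_eq_cons (L' := draws a b) hz (s₀ := Sum.inl i)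
    (f := Sum.map i.succAbove id) hmin (Sum.map_injective.2 ⟨Fin.succAbove_right_injective,
      Function.injective_id⟩) ?_ ?_ mem_draws (nodup_draws _ _) mem_draws (nodup_draws _ _)]
  · simp only [he, List.map_cons, List.map_map]
    congr 1
    refine List.map_congr_left ?_
    rintro (s | s) - <;> rfl
  · rintro (s | s) <;> simp
  · rintro (t | t) ht
    · obtain ⟨j, rfl⟩ := Fin.exists_succAbove_eq (fun h => ht (congrArg _ h) : t ≠ i)
      exact ⟨Sum.inl j, rfl⟩
    · exact ⟨Sum.inr t, rfl⟩

lemma ordering_of_min_inr {a b : ℕ} {z : (Fin a → ℝ) × (Fin (b + 1) → ℝ)}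
    (hz : Function.Injective (Sum.elim z.1 z.2)) {i : Fin (b + 1)}
    (hmin : ∀ s, z.2 i ≤ Sum.elim z.1 z.2 s) :
    ordering a (b + 1) z = true :: ordering a b (z.1, fun j => z.2 (i.succAbove j)) := by
  classical
  have he : ∀ s, Sum.elim z.1 z.2 (Sum.map id i.succAbove s) =
      Sum.elim z.1 (fun j => z.2 (i.succAbove j)) s := by
    rintro (s | s) <;> rfl
  rw [ordering_eq, ordering_eq, insertionSort_eq_cons (L' := draws a b) hz (s₀ := Sum.inr i)
    (f := Sum.map id i.succAbove) hmin (Sum.map_injective.2 ⟨Function.injective_id,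
      Fin.succAbove_right_injective⟩) ?_ ?_ mem_draws (nodup_draws _ _) mem_draws (nodup_draws _ _)]
  · simp only [he, List.map_cons, List.map_map]
    congr 1
    refine List.map_congr_left ?_
    rintro (s | s) - <;> rfl
  · rintro (s | s) <;> simp
  · rintro (t | t) ht
    · exact ⟨Sum.inl t, rfl⟩
    · obtain ⟨j, rfl⟩ := Fin.exists_succAbove_eq (fun h => ht (congrArg _ h) : t ≠ i)
      exact ⟨Sum.inr j, rfl⟩

/-- The first letter is the origin of the smallest draw. Strict inequalities make the events for
different `i` disjoint, as needed for adding their measures. -/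
lemma ordering_eq_false_cons_iff {a b : ℕ} {z : (Fin (a + 1) → ℝ) × (Fin b → ℝ)}
    (hz : Function.Injective (Sum.elim z.1 z.2)) (w : List Bool) :
    ordering (a + 1) b z = false :: w ↔ ∃ i : Fin (a + 1), (∀ j, z.1 i < z.1 (i.succAbove j)) ∧
      (∀ j, z.1 i < z.2 j) ∧ ordering a b (fun j => z.1 (i.succAbove j), z.2) = w := by
  constructor
  · intro h
    obtain ⟨s₀, hs₀⟩ := Finite.exists_min (Sum.elim z.1 z.2)
    rcases s₀ with i | i
    · refine ⟨i, fun j => (hs₀ (Sum.inl _)).lt_of_ne fun h' => ?_,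
        fun j => (hs₀ (Sum.inr j)).lt_of_ne fun h' => ?_, ?_⟩
      · exact Fin.succAbove_ne i j (Sum.inl_injective (hz h')).symm
      · cases hz h'
      · rw [ordering_of_min_inl hz hs₀] at h
        exact (List.cons.inj h).2
    · obtain _ | b := b
      · exact i.elim0
      · rw [ordering_of_min_inr hz hs₀] at h
        cases (List.cons.inj h).1
  · rintro ⟨i, h1, h2, rfl⟩
    refine ordering_of_min_inl hz ?_
    rintro (s | s)
    · rcases eq_or_ne s i with rfl | hs
      · exact le_rfl
      · obtain ⟨j, rfl⟩ := Fin.exists_succAbove_eq hs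
        exact (h1 j).le
    · exact (h2 s).le

lemma ordering_eq_true_cons_iff {a b : ℕ} {z : (Fin a → ℝ) × (Fin (b + 1) → ℝ)}
    (hz : Function.Injective (Sum.elim z.1 z.2)) (w : List Bool) :
    ordering a (b + 1) z = true :: w ↔ ∃ i : Fin (b + 1), (∀ j, z.2 i < z.1 j) ∧
      (∀ j, z.2 i < z.2 (i.succAbove j)) ∧
      ordering a b (z.1, fun j => z.2 (i.succAbove j)) = w := by
  constructor
  · intro h
    obtain ⟨s₀, hs₀⟩ := Finite.exists_min (Sum.elim z.1 z.2)
    rcases s₀ with i | i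
    · obtain _ | a := a
      · exact i.elim0
      · rw [ordering_of_min_inl hz hs₀] at h
        cases (List.cons.inj h).1
    · refine ⟨i, fun j => (hs₀ (Sum.inl j)).lt_of_ne fun h' => ?_,
        fun j => (hs₀ (Sum.inr _)).lt_of_ne fun h' => ?_, ?_⟩
      · cases hz h'
      · exact Fin.succAbove_ne i j (Sum.inr_injective (hz h')).symm
      · rw [ordering_of_min_inr hz hs₀] at h
        exact (List.cons.inj h).2
  · rintro ⟨i, h1, h2, rfl⟩
    refine ordering_of_min_inr hz ?_
    rintro (s | s)
    · exact (h1 s).le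
    · rcases eq_or_ne s i with rfl | hs
      · exact le_rfl
      · obtain ⟨j, rfl⟩ := Fin.exists_succAbove_eq hs
        exact (h2 j).le

/-! ### The law of the ordering as an iterated integral -/

section Law

variable {μ ν : Measure ℝ} [IsFiniteMeasure μ] [IsFiniteMeasure ν]

lemma ae_pi_ne [NullSingletonClass μ] {n : ℕ} {i j : Fin n} (hij : i ≠ j) :
    ∀ᵐ x ∂(Measure.pi fun _ : Fin n => μ), x i ≠ x j := by
  obtain _ | n := n
  · exact i.elim0
  obtain ⟨j, rfl⟩ := Fin.exists_succAbove_eq hij.symm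
  have hmp := measurePreserving_piFinSuccAbove (fun _ : Fin (n + 1) => μ) i
  have h : ∀ᵐ y ∂(μ.prod (Measure.pi fun _ : Fin n => μ)), y.1 ≠ y.2 j := by
    have hm : MeasurableSet {y : ℝ × (Fin n → ℝ) | y.1 ≠ y.2 j} :=
      (measurableSet_eq_fun (by fun_prop) (by fun_prop)).compl
    refine (Measure.ae_prod_iff_ae_ae hm).2 (ae_of_all _ fun t => ?_)
    have := Measure.pi_hyperplane (fun _ : Fin n => μ) j t
    exact (measure_eq_zero_iff_ae_notMem.1 this).mono fun x hx h => hx h.symm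
  exact hmp.quasiMeasurePreserving.ae h

lemma ae_injective_draws [NullSingletonClass μ] [NullSingletonClass ν] (a b : ℕ) :
    ∀ᵐ z ∂((Measure.pi fun _ : Fin a => μ).prod (Measure.pi fun _ : Fin b => ν)),
      Function.Injective (Sum.elim z.1 z.2) := by
  have hlr : ∀ i : Fin a, ∀ j : Fin b,
      ∀ᵐ z ∂((Measure.pi fun _ : Fin a => μ).prod (Measure.pi fun _ : Fin b => ν)),
        z.1 i ≠ z.2 j := by
    intro i j
    have hm : MeasurableSet {z : (Fin a → ℝ) × (Fin b → ℝ) | z.1 i ≠ z.2 j} :=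
      (measurableSet_eq_fun (by fun_prop) (by fun_prop)).compl
    refine (Measure.ae_prod_iff_ae_ae hm).2 (ae_of_all _ fun x => ?_)
    have := Measure.pi_hyperplane (fun _ : Fin b => ν) j (x i)
    exact (measure_eq_zero_iff_ae_notMem.1 this).mono fun y hy h => hy h.symm
  have hll : ∀ i j : Fin a, i ≠ j →
      ∀ᵐ z ∂((Measure.pi fun _ : Fin a => μ).prod (Measure.pi fun _ : Fin b => ν)),
        z.1 i ≠ z.1 j := fun i j hij =>
    Measure.quasiMeasurePreserving_fst.ae (ae_pi_ne hij)
  have hrr : ∀ i j : Fin b, i ≠ j →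
      ∀ᵐ z ∂((Measure.pi fun _ : Fin a => μ).prod (Measure.pi fun _ : Fin b => ν)),
        z.2 i ≠ z.2 j := fun i j hij =>
    Measure.quasiMeasurePreserving_snd.ae (ae_pi_ne hij)
  have h1 := ae_all_iff.2 fun i => ae_all_iff.2 (hlr i)
  have h2 := ae_all_iff.2 fun i => ae_all_iff.2 fun j => ae_all_iff.2 (hll i j)
  have h3 := ae_all_iff.2 fun i => ae_all_iff.2 fun j => ae_all_iff.2 (hrr i j)
  filter_upwards [h1, h2, h3] with z h1 h2 h3
  rintro (i | i) (j | j) h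
  · by_contra hij
    exact h2 i j (fun h' => hij (congrArg _ h')) h
  · exact absurd h (h1 i j)
  · exact absurd h.symm (h1 j i)
  · by_contra hij
    exact h3 i j (fun h' => hij (congrArg _ h')) h

/-- Samples together with a smaller point `y.1`, whose ordering is `w`. -/
def aboveSet (a b : ℕ) (w : List Bool) : Set (ℝ × ((Fin a → ℝ) × (Fin b → ℝ))) :=
  {y | (∀ j, y.1 < y.2.1 j) ∧ (∀ j, y.1 < y.2.2 j) ∧ ordering a b y.2 = w}

lemma measurableSet_aboveSet (a b : ℕ) (w : List Bool) : MeasurableSet (aboveSet a b w) := by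
  have h1 : ∀ j : Fin a, MeasurableSet {y : ℝ × ((Fin a → ℝ) × (Fin b → ℝ)) | y.1 < y.2.1 j} :=
    fun j => measurableSet_lt (by fun_prop) (by fun_prop)
  have h2 : ∀ j : Fin b, MeasurableSet {y : ℝ × ((Fin a → ℝ) × (Fin b → ℝ)) | y.1 < y.2.2 j} :=
    fun j => measurableSet_lt (by fun_prop) (by fun_prop)
  have h3 : MeasurableSet {y : ℝ × ((Fin a → ℝ) × (Fin b → ℝ)) | ordering a b y.2 = w} :=
    ((measurable_ordering a b).comp measurable_snd) (measurableSet_singleton w)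
  have : aboveSet a b w = (⋂ j, {y | y.1 < y.2.1 j}) ∩ ((⋂ j, {y | y.1 < y.2.2 j}) ∩
      {y | ordering a b y.2 = w}) := by
    ext y
    simp [aboveSet]
  rw [this]
  exact (MeasurableSet.iInter h1).inter ((MeasurableSet.iInter h2).inter h3)

/-- Requiring all draws to exceed `t` restricts each factor to `Ioi t`. The restrictions are not
renormalised, so the recursion lives on finite measures. -/
lemma measure_aboveSet (ρ : Measure ℝ) [IsFiniteMeasure ρ] (a b : ℕ) (w : List Bool) :
    (ρ.prod ((Measure.pi fun _ : Fin a => μ).prod (Measure.pi fun _ : Fin b => ν)))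
      (aboveSet a b w) =
      ∫⁻ t, orderingLaw (μ.restrict (Ioi t)) (ν.restrict (Ioi t)) a b {w} ∂ρ := by
  rw [Measure.prod_apply (measurableSet_aboveSet a b w)]
  refine lintegral_congr fun t => ?_
  rw [orderingLaw, Measure.map_apply (measurable_ordering a b) (measurableSet_singleton w),
    ← Measure.restrict_pi_pi, ← Measure.restrict_pi_pi, Measure.prod_restrict,
    Measure.restrict_apply (measurable_ordering a b (measurableSet_singleton w))]
  congr 1
  ext z
  simp only [aboveSet, Set.mem_preimage, Set.mem_inter_iff, Set.mem_prod, Set.mem_pi,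
    Set.mem_univ, true_imp_iff, Set.mem_Ioi, Set.mem_singleton_iff, Set.mem_ofPred_eq]
  tauto

/-- Any of the `a + 1` draws from `μ` may be the smallest, with equal measure by exchangeability;
ties are null. -/
lemma orderingLaw_false_cons [NullSingletonClass μ] [NullSingletonClass ν] (a b : ℕ) (w : List Bool) :
    orderingLaw μ ν (a + 1) b {false :: w} = (a + 1 : ℕ) *
      ∫⁻ t, orderingLaw (μ.restrict (Ioi t)) (ν.restrict (Ioi t)) a b {w} ∂μ := by
  set e : Fin (a + 1) → (Fin (a + 1) → ℝ) × (Fin b → ℝ) → ℝ × ((Fin a → ℝ) × (Fin b → ℝ)) :=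
    fun i z => (z.1 i, (fun j => z.1 (i.succAbove j), z.2)) with he
  have hmp : ∀ i, MeasurePreserving (e i)
      ((Measure.pi fun _ : Fin (a + 1) => μ).prod (Measure.pi fun _ : Fin b => ν))
      (μ.prod ((Measure.pi fun _ : Fin a => μ).prod (Measure.pi fun _ : Fin b => ν))) := by
    intro i
    exact (measurePreserving_prodAssoc _ _ _).comp
      ((measurePreserving_piFinSuccAbove (fun _ : Fin (a + 1) => μ) i).prod
        (MeasurePreserving.id (Measure.pi fun _ : Fin b => ν)))
  rw [orderingLaw, Measure.map_apply (measurable_ordering _ b) (measurableSet_singleton _)]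
  have hae : ordering (a + 1) b ⁻¹' {false :: w} =ᵐ[(Measure.pi fun _ : Fin (a + 1) => μ).prod
      (Measure.pi fun _ : Fin b => ν)] ⋃ i, e i ⁻¹' aboveSet a b w := by
    refine Filter.eventuallyEq_set.2 ?_
    filter_upwards [ae_injective_draws (a + 1) b] with z hz
    rw [Set.mem_iUnion]
    exact ordering_eq_false_cons_iff hz w
  rw [measure_congr hae, measure_iUnion]
  · rw [tsum_fintype, Finset.sum_congr rfl fun i _ =>
      (hmp i).measure_preimage (measurableSet_aboveSet a b w).nullMeasurableSet]
    rw [Finset.sum_const, Finset.card_univ, Fintype.card_fin, nsmul_eq_mul, measure_aboveSet]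
  · intro i i' hii'
    rw [Function.onFun, Set.disjoint_left]
    rintro z ⟨h, -, -⟩ ⟨h', -, -⟩
    obtain ⟨j, hj⟩ := Fin.exists_succAbove_eq hii'.symm
    obtain ⟨j', hj'⟩ := Fin.exists_succAbove_eq hii'
    have h1 := h j
    have h2 := h' j'
    simp only [he, hj, hj'] at h1 h2
    exact lt_asymm h1 h2
  · exact fun i => (hmp i).measurable (measurableSet_aboveSet a b w)

lemma orderingLaw_true_cons [NullSingletonClass μ] [NullSingletonClass ν] (a b : ℕ) (w : List Bool) :
    orderingLaw μ ν a (b + 1) {true :: w} = (b + 1 : ℕ) *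
      ∫⁻ t, orderingLaw (μ.restrict (Ioi t)) (ν.restrict (Ioi t)) a b {w} ∂ν := by
  set e : Fin (b + 1) → (Fin a → ℝ) × (Fin (b + 1) → ℝ) → ℝ × ((Fin a → ℝ) × (Fin b → ℝ)) :=
    fun i z => (z.2 i, (z.1, fun j => z.2 (i.succAbove j))) with he
  have hmp : ∀ i, MeasurePreserving (e i)
      ((Measure.pi fun _ : Fin a => μ).prod (Measure.pi fun _ : Fin (b + 1) => ν))
      (ν.prod ((Measure.pi fun _ : Fin a => μ).prod (Measure.pi fun _ : Fin b => ν))) := by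
    intro i
    exact (measurePreserving_prodAssoc _ _ _).comp
      (((Measure.measurePreserving_swap (μ := Measure.pi fun _ : Fin a => μ) (ν := ν)).prod
        (MeasurePreserving.id (Measure.pi fun _ : Fin b => ν))).comp
      ((MeasurePreserving.symm _ (measurePreserving_prodAssoc (Measure.pi fun _ : Fin a => μ) ν
        (Measure.pi fun _ : Fin b => ν))).comp
      ((MeasurePreserving.id (Measure.pi fun _ : Fin a => μ)).prod
        (measurePreserving_piFinSuccAbove (fun _ : Fin (b + 1) => ν) i))))
  rw [orderingLaw, Measure.map_apply (measurable_ordering a _) (measurableSet_singleton _)]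
  have hae : ordering a (b + 1) ⁻¹' {true :: w} =ᵐ[(Measure.pi fun _ : Fin a => μ).prod
      (Measure.pi fun _ : Fin (b + 1) => ν)] ⋃ i, e i ⁻¹' aboveSet a b w := by
    refine Filter.eventuallyEq_set.2 ?_
    filter_upwards [ae_injective_draws a (b + 1)] with z hz
    rw [Set.mem_iUnion]
    exact ordering_eq_true_cons_iff hz w
  rw [measure_congr hae, measure_iUnion]
  · rw [tsum_fintype, Finset.sum_congr rfl fun i _ =>
      (hmp i).measure_preimage (measurableSet_aboveSet a b w).nullMeasurableSet]
    rw [Finset.sum_const, Finset.card_univ, Fintype.card_fin, nsmul_eq_mul, measure_aboveSet]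
  · intro i i' hii'
    rw [Function.onFun, Set.disjoint_left]
    rintro z ⟨-, h, -⟩ ⟨-, h', -⟩
    obtain ⟨j, hj⟩ := Fin.exists_succAbove_eq hii'.symm
    obtain ⟨j', hj'⟩ := Fin.exists_succAbove_eq hii'
    have h1 := h j
    have h2 := h' j'
    simp only [he, hj, hj'] at h1 h2
    exact lt_asymm h1 h2
  · exact fun i => (hmp i).measurable (measurableSet_aboveSet a b w)

end Law

lemma orderingLaw_eq_zero {μ ν : Measure ℝ} {a b : ℕ} {w : List Bool}
    (h : ¬ (w.count false = a ∧ w.count true = b)) :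
    orderingLaw μ ν a b {w} = 0 := by
  rw [orderingLaw, Measure.map_apply (measurable_ordering a b) (measurableSet_singleton _)]
  convert measure_empty (μ := (Measure.pi fun _ : Fin a => μ).prod (Measure.pi fun _ : Fin b => ν))
  refine Set.eq_empty_of_forall_notMem fun z hz => h ?_
  rw [Set.mem_preimage, Set.mem_singleton_iff] at hz
  rw [← hz, count_false_ordering, count_true_ordering]
  exact ⟨rfl, rfl⟩

lemma orderingLaw_nil {μ ν : Measure ℝ} : orderingLaw μ ν 0 0 {[]} = 1 := by
  rw [orderingLaw, Measure.map_apply (measurable_ordering 0 0) (measurableSet_singleton _)]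
  have : ordering 0 0 ⁻¹' {[]} = univ := by
    refine Set.eq_univ_of_forall fun z => ?_
    simp [ordering, wordOf]
  rw [this, ← univ_prod_univ, Measure.prod_prod]
  simp

/-- The measure on `[0, 1)` with a given density. -/
noncomputable def unitLaw (f : ℝ → ℝ≥0∞) : Measure ℝ :=
  (volume.restrict (Ico 0 1)).withDensity f

lemma lintegral_unitLaw_Ioi {f g : ℝ → ℝ≥0∞} (hf : Measurable f) (hg : Measurable g) {s : ℝ}
    (hs : 0 ≤ s) : ∫⁻ t in Ioi s, g t ∂(unitLaw f) = ∫⁻ t in Ioc s 1, f t * g t := by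
  rw [unitLaw, restrict_withDensity measurableSet_Ioi,
    lintegral_withDensity_eq_lintegral_mul _ hf hg, Measure.restrict_restrict measurableSet_Ioi]
  have : Ioi s ∩ Ico 0 1 = Ioo s 1 := by
    ext t
    simp only [Set.mem_inter_iff, Set.mem_Ioi, Set.mem_Ico, Set.mem_Ioo]
    exact ⟨fun h => ⟨h.1, h.2.2⟩, fun h => ⟨h.1, hs.trans h.1.le, h.2⟩⟩
  rw [this, setLIntegral_congr Ioo_ae_eq_Ioc]
  rfl

/-- Peeling off the smallest draw reproduces the recursion of `iterInt`; the successive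
multiplicities accumulate to the two factorials. -/
lemma orderingLaw_eq_iterInt {f : Bool → ℝ → ℝ≥0∞} (hf : ∀ l, Measurable (f l))
    [hfin : ∀ l, IsFiniteMeasure (unitLaw (f l))] (w : List Bool) {s : ℝ} (hs : 0 ≤ s) :
    orderingLaw ((unitLaw (f false)).restrict (Ioi s)) ((unitLaw (f true)).restrict (Ioi s))
      (w.count false) (w.count true) {w} =
      (w.count false).factorial * (w.count true).factorial * iterInt f 1 w s := by
  have hatoms : ∀ l, NullSingletonClass (unitLaw (f l)) := fun l => by
    unfold unitLaw; infer_instance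
  induction w generalizing s with
  | nil => simpa [iterInt] using orderingLaw_nil
  | cons l w ih =>
    have key : ∀ l' : Bool, ∫⁻ t in Ioi s, orderingLaw
        (((unitLaw (f false)).restrict (Ioi s)).restrict (Ioi t))
        (((unitLaw (f true)).restrict (Ioi s)).restrict (Ioi t)) (w.count false) (w.count true) {w}
          ∂(unitLaw (f l')) =
        (w.count false).factorial * (w.count true).factorial * iterInt f 1 (l' :: w) s := by
      intro l'
      rw [setLIntegral_congr_fun (g := fun t =>
        ((w.count false).factorial * (w.count true).factorial : ℝ≥0∞) * iterInt f 1 w t)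
        measurableSet_Ioi fun t ht => by
          rw [Measure.restrict_restrict measurableSet_Ioi,
            Measure.restrict_restrict measurableSet_Ioi,
            Set.inter_eq_left.2 (Ioi_subset_Ioi (le_of_lt ht)), ih (hs.trans (le_of_lt ht))],
        lintegral_const_mul _ (measurable_iterInt f 1 w),
        lintegral_unitLaw_Ioi (hf l') (measurable_iterInt f 1 w) hs]
      rfl
    cases l
    · rw [List.count_cons_self, List.count_cons_of_ne (by simp), orderingLaw_false_cons, key,
        Nat.factorial_succ]
      push_cast
      ring
    · rw [List.count_cons_self, List.count_cons_of_ne (by simp), orderingLaw_true_cons, key,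
        Nat.factorial_succ]
      push_cast
      ring

/-! ### The joint law of the bit and the word -/

lemma unitLaw_restrict_Ioi (f : ℝ → ℝ≥0∞) : (unitLaw f).restrict (Ioi 0) = unitLaw f := by
  refine Measure.restrict_eq_self_of_ae_mem ((withDensity_absolutelyContinuous _ _).ae_le ?_)
  rw [← Measure.restrict_congr_set (Ioo_ae_eq_Ico (μ := (volume : Measure ℝ)))]
  exact (ae_restrict_mem measurableSet_Ioo).mono fun t ht => ht.1

lemma orderingLaw_eq {k : ℕ} {ε : ℝ} (X : Fin 2) (x : Fin k → ℝ) (w : List Bool) :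
    orderingLaw (pLaw k ε X x) (qLaw k ε X x) (w.count false) (w.count true) {w} =
      (w.count false).factorial * (w.count true).factorial *
        iterInt (fun l t => if l then qDensity k ε X x t else pDensity k ε X x t) 1 w 0 := by
  set f : Bool → ℝ → ℝ≥0∞ := fun l t => if l then qDensity k ε X x t else pDensity k ε X x t
  have hf : ∀ l, Measurable (f l) := fun l => by
    have hq := (measurable_qDensity k ε).comp (measurable_prodMk_left (x := (X, x)))
    have hp := (measurable_pDensity k ε).comp (measurable_prodMk_left (x := (X, x)))
    cases l
    · exact hp
    · exact hq
  have hp : unitLaw (f false) = pLaw k ε X x := rfl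
  have hq : unitLaw (f true) = qLaw k ε X x := rfl
  have hfin : ∀ l, IsFiniteMeasure (unitLaw (f l)) := fun l => by
    cases l
    · rw [hp]; infer_instance
    · rw [hq]; infer_instance
  have h := orderingLaw_eq_iterInt hf w le_rfl
  rwa [unitLaw_restrict_Ioi, unitLaw_restrict_Ioi] at h

lemma lintegral_poisson_orderingLaw {k : ℕ} {ε : ℝ} (m : ℝ≥0) (X : Fin 2) (x : Fin k → ℝ)
    (w : List Bool) :
    ∫⁻ n, orderingLaw (pLaw k ε X x) (qLaw k ε X x) n.1 n.2 {w}
      ∂((poissonMeasure m).prod (poissonMeasure m)) =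
      ENNReal.ofReal (Real.exp (-(2 * m))) * iterInt (letterDensity k ε m X x) 1 w 0 := by
  -- A word determines both sample sizes, so only one pair `n` contributes.
  have h : ∀ n : ℕ × ℕ, orderingLaw (pLaw k ε X x) (qLaw k ε X x) n.1 n.2 {w} =
      ({(w.count false, w.count true)} : Set (ℕ × ℕ)).indicator (fun _ =>
        orderingLaw (pLaw k ε X x) (qLaw k ε X x) (w.count false) (w.count true) {w}) n := by
    intro n
    by_cases hn : n = (w.count false, w.count true)
    · subst hn; simp
    · rw [Set.indicator_of_notMem (by simpa using hn)]
      exact orderingLaw_eq_zero fun h' => hn (Prod.ext h'.1.symm h'.2.symm)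
  have hlen : w.length = w.count false + w.count true := by
    rw [← List.count_not_add_count w true]
    rfl
  -- The factorials of the Poisson probabilities cancel those counting the labelled draws.
  have hpois : (poissonMeasure m {w.count false} * poissonMeasure m {w.count true}) *
      ((w.count false).factorial * (w.count true).factorial) =
      ENNReal.ofReal (Real.exp (-(2 * m))) * (m : ℝ≥0∞) ^ w.length := by
    rw [poissonMeasure_singleton, poissonMeasure_singleton,
      ← ENNReal.ofReal_natCast (w.count false).factorial,
      ← ENNReal.ofReal_natCast (w.count true).factorial, ← ENNReal.ofReal_mul (by positivity),
      ← ENNReal.ofReal_mul (by positivity), ← ENNReal.ofReal_mul (by positivity),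
      ← ENNReal.ofReal_coe_nnreal, ← ENNReal.ofReal_pow (by positivity),
      ← ENNReal.ofReal_mul (by positivity)]
    congr 1
    rw [hlen, two_mul, neg_add, Real.exp_add, pow_add]
    have h1 := Nat.factorial_ne_zero (w.count false)
    have h2 := Nat.factorial_ne_zero (w.count true)
    field_simp
  rw [lintegral_congr h, lintegral_indicator_const (measurableSet_singleton _), orderingLaw_eq,
    ← Set.singleton_prod_singleton, Measure.prod_prod]
  have h2 : iterInt (letterDensity k ε m X x) 1 w 0 = (m : ℝ≥0∞) ^ w.length *
      iterInt (fun l t => if l then qDensity k ε X x t else pDensity k ε X x t) 1 w 0 :=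
    iterInt_smul (m : ℝ≥0∞) ENNReal.coe_ne_top 1 w 0
  rw [h2, ← mul_assoc (ENNReal.ofReal _), ← hpois]
  ring

lemma jointLaw_singleton {k : ℕ} {ε : ℝ} (hk : 0 < k) (hε : ε < 1) (m : ℝ≥0) (X : Fin 2)
    (w : List Bool) :
    jointLaw k ε m {(X, w)} = 2⁻¹ * (ENNReal.ofReal (Real.exp (-(2 * m))) *
      ∫⁻ x, iterInt (letterDensity k ε m X x) 1 w 0 ∂(positionLaw k ε)) := by
  have hk' : (0 : ℝ) < k := by exact_mod_cast hk
  have hprob := isProbabilityMeasure_cond_Icc (D := (1 - ε) / k) (div_pos (by linarith) hk')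
  have hf : Measurable fun a : ((Fin 2 × (Fin k → ℝ)) × (ℕ × ℕ)) × List Bool =>
    (a.1.1.1, a.2) := by fun_prop
  have hpre : ∀ a : (Fin 2 × (Fin k → ℝ)) × (ℕ × ℕ), orderingKernel k ε a (Prod.mk a ⁻¹'
      ((fun a : ((Fin 2 × (Fin k → ℝ)) × (ℕ × ℕ)) × List Bool => (a.1.1.1, a.2)) ⁻¹' {(X, w)})) =
      ({X} : Set (Fin 2)).indicator (fun _ => orderingKernel k ε a {w}) a.1.1 := by
    intro a
    by_cases ha : a.1.1 = X
    · rw [Set.indicator_of_mem (by simpa using ha)]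
      congr 1
      ext v
      simp [ha]
    · rw [Set.indicator_of_notMem (by simpa using ha)]
      convert measure_empty (μ := orderingKernel k ε a)
      ext v
      simp [ha]
  have hG : Measurable fun a : (Fin 2 × (Fin k → ℝ)) × (ℕ × ℕ) =>
      ({X} : Set (Fin 2)).indicator (fun _ => orderingKernel k ε a {w}) a.1.1 := by
    have h1 : Measurable fun a => orderingKernel k ε a {w} :=
      Kernel.measurable_coe _ (measurableSet_singleton w)
    have h2 : MeasurableSet {a : (Fin 2 × (Fin k → ℝ)) × (ℕ × ℕ) | a.1.1 = X} :=
      (measurable_fst.comp measurable_fst) (measurableSet_singleton X)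
    exact h1.indicator h2
  rw [jointLaw, Measure.map_apply hf (measurableSet_singleton _), setupLaw,
    Measure.compProd_apply (hf (measurableSet_singleton _)), lintegral_congr hpre,
    lintegral_prod _ hG.aemeasurable]
  have hinner : ∀ a : Fin 2 × (Fin k → ℝ), ∫⁻ n, ({X} : Set (Fin 2)).indicator
      (fun _ => orderingKernel k ε (a, n) {w}) a.1 ∂((poissonMeasure m).prod (poissonMeasure m)) =
      ({X} : Set (Fin 2)).indicator (fun _ => ENNReal.ofReal (Real.exp (-(2 * m))) *
        iterInt (letterDensity k ε m X a.2) 1 w 0) a.1 := by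
    rintro ⟨X', x⟩
    by_cases ha : X' = X
    · subst ha
      simp only [Set.mem_singleton_iff, Set.indicator_of_mem]
      exact lintegral_poisson_orderingLaw m X' x w
    · simp [ha]
  have hmeas : Measurable fun a : Fin 2 × (Fin k → ℝ) => ({X} : Set (Fin 2)).indicator
      (fun _ => ENNReal.ofReal (Real.exp (-(2 * m))) *
        iterInt (letterDensity k ε m X a.2) 1 w 0) a.1 := by
    rw [← funext hinner]
    exact hG.lintegral_prod_right'
  rw [lintegral_congr hinner, lintegral_prod _ hmeas.aemeasurable]
  have hX : ∀ X' : Fin 2, ∫⁻ x, ({X} : Set (Fin 2)).indicator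
      (fun _ => ENNReal.ofReal (Real.exp (-(2 * m))) *
        iterInt (letterDensity k ε m X x) 1 w 0) X' ∂(positionLaw k ε) =
      ({X} : Set (Fin 2)).indicator (fun _ => ENNReal.ofReal (Real.exp (-(2 * m))) *
        ∫⁻ x, iterInt (letterDensity k ε m X x) 1 w 0 ∂(positionLaw k ε)) X' := by
    intro X'
    by_cases ha : X' = X
    · subst ha
      simp only [Set.mem_singleton_iff, Set.indicator_of_mem]
      exact lintegral_const_mul' _ _ ENNReal.ofReal_ne_top
    · simp [ha]
  rw [lintegral_congr hX, lintegral_indicator_const (measurableSet_singleton X), mul_comm]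
  congr 1
  rw [uniformOn_univ]
  simp

/-- The law of the word, given the bit. -/
noncomputable def wordMass (k : ℕ) (ε δ m : ℝ≥0) (X : Fin 2) (w : List Bool) : ℝ≥0 :=
  (Real.exp (-(2 * m))).toNNReal *
    if X = 0 then convFold (List.replicate k (macroWeight (m / k) ε δ)) w
    else flat (fun _ => m) w

lemma jointLaw_singleton_eq {k : ℕ} (hk : 0 < k) {ε δ : ℝ≥0} (hεδ : ε + δ = 1) (hδ : 0 < δ)
    (m : ℝ≥0) (X : Fin 2) (w : List Bool) :
    jointLaw k ε m {(X, w)} = 2⁻¹ * wordMass k ε δ m X w := by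
  have hε : (ε : ℝ) < 1 := by
    rw [← NNReal.coe_one, NNReal.coe_lt_coe, ← hεδ]
    exact lt_add_of_pos_right _ hδ
  have hk' : (0 : ℝ) < k := by exact_mod_cast hk
  have hprob := isProbabilityMeasure_cond_Icc (D := (1 - ε) / k) (div_pos (by linarith) hk')
  rw [jointLaw_singleton hk hε, wordMass, ENNReal.coe_mul]
  congr 2
  match X with
  | 0 => rw [lintegral_iterInt_zero hk hεδ hδ, if_pos rfl]
  | 1 =>
    have h : ∀ x : Fin k → ℝ, iterInt (letterDensity k ε m 1 x) 1 w 0 =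
        flat (fun _ => m) w := fun x => by
      rw [iterInt_eq_flat (c := fun _ => m) 1 (by simp)
        fun l t _ => letterDensity_one k ε m x l t]
      simp
    simp_rw [h]
    simp

/-! ### Total mass and second moment of the word laws. -/

lemma tsum_flat (c : ℝ≥0) :
    ∑' w, (flat (fun _ => c) w : ℝ≥0∞) = ENNReal.ofReal (Real.exp (2 * c)) := by
  rw [tsum_list_eq, ← tsum_pow_div_factorial (by positivity)]
  refine tsum_congr fun n => ?_
  have h := sumLen_flat n fun _ => c
  rw [← two_mul] at h
  rw [sumLen, ← ENNReal.ofNNReal_finsetSum]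
  rw [sumLen] at h
  rw [h, ← ENNReal.ofReal_coe_nnreal]
  push_cast
  rfl

lemma sumLen_macroRatio {ε δ : ℝ≥0} (h : ε + δ = 1) (n : ℕ) :
    sumLen n (macroRatio miniRatio ε δ) = 2 ^ n := by
  rw [sumLen_congr (G := fun w => ∑ p ∈ blocks n, binomWeight ε δ n p.1 / (n - p.1 + 1 : ℕ) *
    miniRatio ((w.drop p.2).take p.1)) fun w hw => by rw [macroRatio, hw], sumLen_sum]
  simp_rw [sumLen_mul_left]
  rw [Finset.sum_congr rfl fun p hp => by
    rw [sumLen_factor sumLen_miniRatio (mem_blocks.1 hp)], ← Finset.sum_mul, sum_binomWeight h,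
    one_mul]

lemma tsum_macroWeight {ε δ : ℝ≥0} (h : ε + δ = 1) (t : ℝ≥0) :
    ∑' w, (macroWeight t ε δ w : ℝ≥0∞) = ENNReal.ofReal (Real.exp (2 * t)) := by
  rw [← tsum_flat, tsum_list_eq, tsum_list_eq]
  refine tsum_congr fun n => ?_
  rw [sumLen, sumLen, ← ENNReal.ofNNReal_finsetSum, ← ENNReal.ofNNReal_finsetSum]
  change ((sumLen n (macroWeight t ε δ) : ℝ≥0) : ℝ≥0∞) = (sumLen n (flat fun _ => t) : ℝ≥0)
  rw [sumLen_congr (G := fun w => t ^ n / n.factorial * macroRatio miniRatio ε δ w) fun w hw => by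
    rw [macroWeight_eq, flat_const, hw], sumLen_mul_left, sumLen_macroRatio h, sumLen_flat,
    ← two_mul, mul_pow]
  congr 1
  ring

lemma tsum_convFold (A : List Bool → ℝ≥0) (k : ℕ) :
    ∑' w, ((convFold (List.replicate k A) w : ℝ≥0) : ℝ≥0∞) = (∑' w, (A w : ℝ≥0∞)) ^ k := by
  induction k with
  | zero =>
    rw [tsum_eq_single ([] : List Bool) fun w hw => ?_]
    · simp [convFold, convOne]
    · cases w <;> simp_all [convFold, convOne]
  | succ k ih =>
    simp only [convFold, List.replicate_succ, List.foldr_cons] at ih ⊢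
    simp_rw [coe_conv]
    rw [tsum_conv, ih, pow_succ']

lemma tsum_wordMass {k : ℕ} (hk : 0 < k) {ε δ : ℝ≥0} (hεδ : ε + δ = 1) (m : ℝ≥0) (X : Fin 2) :
    ∑' w, (wordMass k ε δ m X w : ℝ≥0∞) = 1 := by
  have hk' : (k : ℝ) ≠ 0 := by positivity
  simp only [wordMass, ENNReal.coe_mul]
  rw [ENNReal.tsum_mul_left]
  change ENNReal.ofReal _ * _ = _
  have h : ∑' w, ((if X = 0 then convFold (List.replicate k (macroWeight (m / k) ε δ)) w
      else flat (fun _ => m) w : ℝ≥0) : ℝ≥0∞) = ENNReal.ofReal (Real.exp (2 * m)) := by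
    split_ifs
    · rw [tsum_convFold, tsum_macroWeight hεδ, ← ENNReal.ofReal_pow (by positivity),
        ← Real.exp_nat_mul]
      congr 2
      push_cast
      field_simp
    · exact tsum_flat m
  rw [h, ← ENNReal.ofReal_mul (by positivity), ← Real.exp_add]
  simp

/-- The bucket bound is relaxed by `1 + u ≤ exp u`, so its `k`-th power is an exponential, and `k *
(m / k) ^ 5 = m ^ 5 / k ^ 4`. -/
lemma chi_wordMass_le {k : ℕ} (hk : 0 < k) {ε δ : ℝ≥0} (hεδ : ε + δ = 1) {m : ℝ≥0}
    (hkm : (k : ℝ≥0) ≤ m) (hmε : m * ε ≤ k) :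
    chi (wordMass k ε δ m 0) (wordMass k ε δ m 1) ≤
      ENNReal.ofReal (Real.exp (macroConst * ((m : ℝ) ^ 5 * (ε : ℝ) ^ 6 / (k : ℝ) ^ 4))) := by
  have hk0 : (0 : ℝ≥0) < k := by exact_mod_cast hk
  have hkr : (0 : ℝ) < k := by exact_mod_cast hk
  set E := (Real.exp (-(2 * m))).toNNReal with hE
  have hE0 : E ≠ 0 := (Real.toNNReal_pos.2 (Real.exp_pos _)).ne'
  -- `P ^ 2 / Q` is homogeneous of degree one, so a single normalising factor survives; it cancels
  -- `exp (2 m / k) ^ k` below.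
  have h1 : chi (wordMass k ε δ m 0) (wordMass k ε δ m 1) =
      E * chi (convFold (List.replicate k (macroWeight (m / k) ε δ))) (flat fun _ => m) := by
    rw [chi, chi, ← ENNReal.tsum_mul_left]
    refine tsum_congr fun w => ?_
    rw [← ENNReal.coe_mul]
    congr 1
    simp only [wordMass, if_true, one_ne_zero, if_false, ← hE]
    field_simp
  obtain ⟨k', rfl⟩ := Nat.exists_eq_add_of_le' hk
  have hchi := chi_convFold_le (macroWeight (m / (k' + 1 : ℕ)) ε δ)
    (c := m / (k' + 1 : ℕ)) (div_pos (hk0.trans_le hkm) hk0) k'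
  rw [show ((k' : ℝ≥0) + 1) * (m / (k' + 1 : ℕ)) = m by
    push_cast; field_simp] at hchi
  have hbucket := chi_macroWeight_le hεδ (t := m / (k' + 1 : ℕ)) ((one_le_div₀ hk0).2 hkm)
    (by rw [div_mul_eq_mul_div]; exact (div_le_one hk0).2 hmε)
  rw [h1]
  set K : ℝ := ((k' + 1 : ℕ) : ℝ) with hK
  set u : ℝ := macroConst * (((m : ℝ) / K) ^ 5 * (ε : ℝ) ^ 6) with hu
  have hu0 : 0 ≤ u := by
    have : 0 ≤ macroConst := by unfold macroConst; positivity
    positivity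
  have hbucket' : chi (macroWeight (m / (k' + 1 : ℕ)) ε δ) (flat fun _ => m / (k' + 1 : ℕ)) ≤
      ENNReal.ofReal (Real.exp (2 * (m / K)) * Real.exp u) := by
    refine hbucket.trans (ENNReal.ofReal_le_ofReal ?_)
    push_cast
    rw [hK] at hu
    push_cast at hu
    rw [hK]
    push_cast
    rw [← hu]
    gcongr
    linarith [Real.add_one_le_exp u]
  calc _ ≤ (E : ℝ≥0∞) * ENNReal.ofReal (Real.exp (2 * (m / K)) * Real.exp u) ^ (k' + 1) := by
        gcongr
        exact hchi.trans (pow_le_pow_left' hbucket' _)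
    _ = ENNReal.ofReal (Real.exp (-(2 * m)) *
          (Real.exp (2 * (m / K)) * Real.exp u) ^ (k' + 1)) := by
        rw [ENNReal.ofReal_mul (p := Real.exp (-(2 * m))) (by positivity),
          ENNReal.ofReal_pow (by positivity)]
        rfl
    _ = _ := by
        congr 1
        rw [← Real.exp_add, ← Real.exp_nat_mul, ← Real.exp_add, ← hK, hu]
        congr 1
        field_simp
        ring

/-! ### Mutual information of a bit and a discrete variable -/

/-- From `log x ≤ x - 1`; this is the pointwise form of the bound of Kullback-Leibler by chi-square
divergence. -/
lemma klFun_le_sq {x : ℝ} (hx : 0 ≤ x) : InformationTheory.klFun x ≤ (x - 1) ^ 2 := by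
  rw [InformationTheory.klFun_apply]
  rcases hx.eq_or_lt with rfl | hx
  · simp
  · nlinarith [Real.log_le_sub_one_of_pos hx]

lemma rnDeriv_mul_singleton {α : Type*} [MeasurableSpace α] [MeasurableSingletonClass α]
    {μ ν : Measure α} [IsFiniteMeasure μ] [IsFiniteMeasure ν] (h : μ ≪ ν) (a : α) :
    μ.rnDeriv ν a * ν {a} = μ {a} := by
  conv_rhs => rw [← Measure.withDensity_rnDeriv_eq μ ν h]
  rw [withDensity_apply _ (measurableSet_singleton a), lintegral_singleton]

lemma klDiv_le_tsum {α : Type*} [Countable α] [MeasurableSpace α] [MeasurableSingletonClass α]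
    {μ ν : Measure α} [IsFiniteMeasure μ] [IsFiniteMeasure ν] {f g : α → ℝ≥0}
    (hμ : ∀ a, μ {a} = f a) (hν : ∀ a, ν {a} = g a) (hg : ∀ a, 0 < g a) :
    InformationTheory.klDiv μ ν ≤
      ∑' a, ENNReal.ofReal (((f a : ℝ) - g a) ^ 2 / g a) := by
  have hac : μ ≪ ν := by
    refine Measure.AbsolutelyContinuous.mk fun s _ hs => ?_
    suffices s = ∅ by simp [this]
    refine Set.eq_empty_of_forall_notMem fun a ha => ?_
    have := measure_mono_null (Set.singleton_subset_iff.2 ha) hs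
    rw [hν, ENNReal.coe_eq_zero] at this
    exact (hg a).ne' this
  rw [InformationTheory.klDiv_eq_lintegral_klFun_of_ac hac, lintegral_countable']
  refine ENNReal.tsum_le_tsum fun a => ?_
  have hgr : (0 : ℝ) < g a := hg a
  have hd : μ.rnDeriv ν a = (f a / g a : ℝ≥0) := by
    have h := rnDeriv_mul_singleton hac a
    rw [hμ, hν] at h
    rw [ENNReal.coe_div (hg a).ne', ← h, ENNReal.mul_div_cancel_right
      (by simpa using (hg a).ne') ENNReal.coe_ne_top]
  rw [hd, hν, ENNReal.coe_toReal, ← ENNReal.ofReal_coe_nnreal,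
    ← ENNReal.ofReal_mul' (g a).coe_nonneg]
  refine ENNReal.ofReal_le_ofReal ?_
  calc _ ≤ (((f a / g a : ℝ≥0) : ℝ) - 1) ^ 2 * g a := by
        gcongr
        exact klFun_le_sq (NNReal.coe_nonneg _)
    _ = _ := by
        push_cast
        field_simp

lemma mutualInfo_le_tsum {β : Type*} [Countable β] [MeasurableSpace β]
    [DiscreteMeasurableSpace β] {ρ : Measure (Fin 2 × β)} {r : Fin 2 → β → ℝ≥0}
    (hρ : ∀ X w, ρ {(X, w)} = 2⁻¹ * r X w) (hr : ∀ X, ∑' w, (r X w : ℝ≥0∞) = 1)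
    (hpos : ∀ w, 0 < r 1 w) :
    mutualInfo ρ ≤
      ∑' w, ENNReal.ofReal (((r 0 w : ℝ) - r 1 w) ^ 2 / (2 * (r 0 w + r 1 w))) := by
  have hfst : ∀ X, ρ.fst {X} = 2⁻¹ := by
    intro X
    rw [Measure.fst_apply (measurableSet_singleton X)]
    have : (Prod.fst ⁻¹' {X} : Set (Fin 2 × β)) = ⋃ w, {(X, w)} := by
      ext ⟨Y, w⟩
      simp [Prod.ext_iff, eq_comm]
    rw [this, measure_iUnion _ fun w => measurableSet_singleton _]
    · simp_rw [hρ]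
      rw [ENNReal.tsum_mul_left, hr, mul_one]
    · intro w w' hw
      simpa [Function.onFun] using hw
  have hsnd : ∀ w, ρ.snd {w} = ((r 0 w + r 1 w) / 2 : ℝ≥0) := by
    intro w
    rw [Measure.snd_apply (measurableSet_singleton w)]
    have : (Prod.snd ⁻¹' {w} : Set (Fin 2 × β)) = {(0, w)} ∪ {(1, w)} := by
      ext ⟨Y, w'⟩
      match Y with
      | 0 => simp
      | 1 => simp
    rw [this, measure_union (by simp) (measurableSet_singleton _), hρ, hρ,
      ENNReal.coe_div two_ne_zero, ← mul_add, mul_comm, ENNReal.div_eq_inv_mul]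
    push_cast
    ring
  have huniv : ρ univ = 1 := by
    rw [← Measure.fst_univ, ← Finset.coe_univ, ← sum_measure_singleton]
    simp only [hfst, Fin.sum_univ_two]
    exact ENNReal.inv_two_add_inv_two
  have hprob : IsProbabilityMeasure ρ := ⟨huniv⟩
  have h2 : (2⁻¹ : ℝ≥0∞) = ((2⁻¹ : ℝ≥0) : ℝ≥0∞) := by
    rw [ENNReal.coe_inv two_ne_zero]; rfl
  -- The joint mass is compared with half the mixture `(r 0 + r 1) / 2`; the two values of the bit
  -- contribute equally.
  refine (klDiv_le_tsum (f := fun a => 2⁻¹ * r a.1 a.2)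
    (g := fun a => 2⁻¹ * ((r 0 a.2 + r 1 a.2) / 2)) ?_ ?_ ?_).trans ?_
  · rintro ⟨X, w⟩
    rw [hρ, h2, ← ENNReal.coe_mul]
  · rintro ⟨X, w⟩
    rw [← Set.singleton_prod_singleton, Measure.prod_prod, hfst, hsnd, h2, ← ENNReal.coe_mul]
  · rintro ⟨X, w⟩
    have := hpos w
    positivity
  · rw [ENNReal.tsum_prod', tsum_fintype, Fin.sum_univ_two, ← ENNReal.tsum_add]
    refine ENNReal.tsum_le_tsum fun w => ?_
    have h1 : (0 : ℝ) < r 1 w := hpos w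
    have h0 : (0 : ℝ) ≤ r 0 w := (r 0 w).coe_nonneg
    rw [← ENNReal.ofReal_add (by positivity) (by positivity)]
    refine ENNReal.ofReal_le_ofReal (le_of_eq ?_)
    push_cast
    field_simp
    ring

lemma mutualInfo_le_of_chi_le {ρ : Measure (Fin 2 × List Bool)} {r : Fin 2 → List Bool → ℝ≥0}
    (hρ : ∀ X w, ρ {(X, w)} = 2⁻¹ * r X w) (hr : ∀ X, ∑' w, (r X w : ℝ≥0∞) = 1)
    (hpos : ∀ w, 0 < r 1 w) {y : ℝ} (hy : 0 ≤ y)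
    (hchi : chi (r 0) (r 1) ≤ ENNReal.ofReal (Real.exp y)) :
    mutualInfo ρ ≤ ENNReal.ofReal y := by
  refine (mutualInfo_le_tsum hρ hr hpos).trans ?_
  set T : List Bool → ℝ≥0∞ := fun w =>
    ENNReal.ofReal (((r 0 w : ℝ) - r 1 w) ^ 2 / (2 * (r 0 w + r 1 w))) with hT
  -- This crude bound settles `y ≥ 1` and supplies the finiteness needed to pass to real numbers.
  have hone : ∑' w, T w ≤ 1 := by
    have h : ∀ w, 2 * T w ≤ r 0 w + r 1 w := by
      intro w
      have h1 : (0 : ℝ) < r 1 w := hpos w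
      have h0 : (0 : ℝ) ≤ r 0 w := (r 0 w).coe_nonneg
      rw [← ENNReal.ofReal_coe_nnreal, ← ENNReal.ofReal_coe_nnreal,
        ← ENNReal.ofReal_add h0 h1.le, ← ENNReal.ofReal_ofNat 2, ← ENNReal.ofReal_mul (by simp)]
      refine ENNReal.ofReal_le_ofReal ?_
      rw [← mul_div_assoc, div_le_iff₀ (by positivity)]
      nlinarith [mul_nonneg h0 h1.le]
    have hsum := ENNReal.tsum_le_tsum h
    rw [ENNReal.tsum_mul_left, ENNReal.tsum_add, hr, hr, one_add_one_eq_two] at hsum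
    have h2 : (2 : ℝ≥0∞) * ∑' w, T w ≤ 2 * 1 := by rwa [mul_one]
    exact (ENNReal.mul_le_mul_iff_right two_ne_zero ENNReal.ofNat_ne_top).1 h2
  have htop : ∑' w, T w ≠ ∞ := ne_top_of_le_ne_top ENNReal.one_ne_top hone
  rcases le_or_gt 1 y with hy1 | hy1
  · exact hone.trans (by simpa using hy1)
  have hkey : 2 * ∑' w, T w + 1 ≤ ENNReal.ofReal (Real.exp y) := by
    -- This is `2 T ≤ (r 0 - r 1) ^ 2 / r 1` with the square expanded and the negative term moved
    -- left, which avoids subtraction in `ℝ≥0∞`.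
    have h : ∀ w, 2 * T w + 2 * r 0 w ≤ ((r 0 w ^ 2 / r 1 w : ℝ≥0) : ℝ≥0∞) + r 1 w := by
      intro w
      have h1 : (0 : ℝ) < r 1 w := hpos w
      have h0 : (0 : ℝ) ≤ r 0 w := (r 0 w).coe_nonneg
      simp only [hT]
      rw [← ENNReal.ofReal_coe_nnreal (p := r 0 w), ← ENNReal.ofReal_coe_nnreal (p := r 1 w),
        ← ENNReal.ofReal_coe_nnreal (p := r 0 w ^ 2 / r 1 w),
        ← ENNReal.ofReal_ofNat 2, ← ENNReal.ofReal_mul (by simp), ← ENNReal.ofReal_mul (by simp),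
        ← ENNReal.ofReal_add (by positivity) (by positivity),
        ← ENNReal.ofReal_add (by positivity) (by positivity)]
      refine ENNReal.ofReal_le_ofReal ?_
      push_cast
      have h3 : ((r 0 w : ℝ) - r 1 w) ^ 2 / (2 * (r 0 w + r 1 w)) ≤
          ((r 0 w : ℝ) - r 1 w) ^ 2 / (2 * r 1 w) := by
        gcongr
        linarith
      have h4 : 2 * (((r 0 w : ℝ) - r 1 w) ^ 2 / (2 * r 1 w)) + 2 * r 0 w =
          (r 0 w : ℝ) ^ 2 / r 1 w + r 1 w := by
        field_simp
        ring
      linarith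
    have hsum := ENNReal.tsum_le_tsum h
    rw [ENNReal.tsum_add, ENNReal.tsum_add, ENNReal.tsum_mul_left, ENNReal.tsum_mul_left, hr, hr,
      mul_one, ← one_add_one_eq_two (R := ℝ≥0∞), ← add_assoc] at hsum
    rw [one_add_one_eq_two] at hsum
    exact ((ENNReal.add_le_add_iff_right ENNReal.one_ne_top).1 hsum).trans hchi
  rw [ENNReal.le_ofReal_iff_toReal_le htop hy]
  have hreal := (ENNReal.le_ofReal_iff_toReal_le (by finiteness) (Real.exp_pos y).le).1 hkey
  rw [ENNReal.toReal_add (by finiteness) ENNReal.one_ne_top, ENNReal.toReal_mul,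
    ENNReal.toReal_ofNat, ENNReal.toReal_one] at hreal
  -- For `0 ≤ y ≤ 1` one has `exp y - 1 ≤ 2 y`, and the factor `2` matches the one in front of the
  -- sum.
  have hexp := (abs_le.1 (Real.abs_exp_sub_one_le (abs_le.2 ⟨by linarith, hy1.le⟩))).2
  rw [abs_of_nonneg hy] at hexp
  linarith

end OrderedSampling

/-! ### The main theorem. -/

theorem mainTheorem8 :
    ∃ c : ℝ, 0 < c ∧ ∃ C : ℝ, 0 < C ∧
      ∀ (k : ℕ) (m : ℝ≥0) (ε : ℝ), 1 ≤ k → 0 < m → 0 < ε → ε < 1 →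
        (m : ℝ) * ε ≤ c * k →
        Real.log ((m : ℝ) * k / ε) ≤ c * ε⁻¹ →
        (k : ℝ) ≤ c * m →
        OrderedSampling.mutualInfo (OrderedSampling.jointLaw k ε m) ≤
          ENNReal.ofReal (C * ((m : ℝ) ^ 5 * ε ^ 6 / (k : ℝ) ^ 4)) := by
  have hC : 0 < OrderedSampling.macroConst := by
    unfold OrderedSampling.macroConst
    positivity
  -- With `c = 1` the hypotheses give `t ≥ 1` and `t ε ≤ 1` for `t = m / k`, as the one-bucket bound
  -- requires.
  refine ⟨1, one_pos, OrderedSampling.macroConst, hC, ?_⟩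
  intro k m ε hk hm hε hε1 hmε _ hkm
  lift ε to ℝ≥0 using hε.le
  rw [one_mul] at hmε hkm
  have hεδ : ε + (1 - ε) = 1 := add_tsub_cancel_of_le (by exact_mod_cast hε1.le)
  have hδ : 0 < 1 - ε := tsub_pos_of_lt (by exact_mod_cast hε1)
  refine OrderedSampling.mutualInfo_le_of_chi_le
    (OrderedSampling.jointLaw_singleton_eq hk hεδ hδ m) (OrderedSampling.tsum_wordMass hk hεδ m)
    (fun w => ?_) (by positivity)
    (OrderedSampling.chi_wordMass_le hk hεδ (by exact_mod_cast hkm) (by exact_mod_cast hmε))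
  exact mul_pos (Real.toNNReal_pos.2 (Real.exp_pos _)) (OrderedSampling.flat_pos hm w)
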